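/- **Theorem 5.7.** Let $\mathcal A$ be a weakly idempotent complete exact category, i.e. an additive category with an exact structure in the sense of Quillen, in which every split epimorphism has a kernel. A cotorsion pair is a pair $(\mathcal X,\mathcal Y)$ of classes of objects with $\mathcal X=\{X \mid \operatorname{Ext}^1(X,Y)=0\ \forall\, Y\in\mathcal Y\}$ and $\mathcal Y=\{Y \mid \operatorname{Ext}^1(X,Y)=0\ \forall\, X\in\mathcal X\}$. It is complete if every object $M$ fits into admissible exact sequences $0\to Y\to X\to M\to 0$ and $0\to M\to Y'\to X'\to 0$ with $X,X'\in\mathcal X$ and $Y,Y'\in\mathcal Y$. It is hereditary if $\mathcal X$ is closed under kernels of deflations (between objects of $\mathcal X$) and $\mathcal Y$ is closed under cokernels of inflations (between objects of $\mathcal Y$). A class $\omega$ of objects is covariantly finite if for every object $M$ there is a morphism $M\to W$ with $W\in\omega$ through which every morphism from $M$ to an object of $\omega$ factors. Let $S^C$ be the class of hereditary complete cotorsion pairs $(\mathcal X,\mathcal Y)$ in $\mathcal A$ whose core $\omega=\mathcal X\cap\mathcal Y$ is covariantly finite. A (closed) model structure on $\mathcal A$ is a triple $(\mathrm{CoFib},\mathrm{Fib},\mathrm{Weq})$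 of classes of morphisms (cofibrations, fibrations, weak equivalences) satisfying the two-out-of-three axiom for $\mathrm{Weq}$, the retract axiom for all three classes, the lifting axiom, and the factorization axiom; no existence of limits or colimits is required. An object $X$ is cofibrant if $0\to X$ is in $\mathrm{CoFib}$, fibrant if $X\to 0$ is in $\mathrm{Fib}$, trivial if $0\to X$ is in $\mathrm{Weq}$, and trivially cofibrant if it is both trivial and cofibrant. A trivial cofibration is a morphism in $\mathrm{CoFib}\cap\mathrm{Weq}$. A model structure on $\mathcal A$ is weakly injective if $\mathrm{Fib}$ is precisely the class of deflations with fibrant kernel, each trivial cofibration is an inflation, and each object is cofibrant. Let $S^M$ be the class of weakly injective model structures on $\mathcal A$. For $(\mathcal X,\mathcal Y)\in S^C$ with $\omega=\mathcal X\cap\mathcal Y$ define: - $\mathrm{CoFib}^\omega$: the morphisms $f:A\to B$ such that $\operatorname{Hom}(f,W):\operatorname{Hom}(B,W)\to\operatorname{Hom}(A,W)$ is surjective for every $W\in\omega$; - $\mathrm{Fib}^\omega$: the deflations with kernel in $\mathcal Y$; - $\mathrm{Weq}^\omega$: the morphisms $f:A\to B$ for which there are $W\in\omega$ and $t:A\to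 W$ such that $\binom{f}{t}:A\to B\oplus W$ is an inflation with cokernel in $\mathcal X$. Then $\Phi:(\mathcal X,\mathcal Y)\mapsto(\mathrm{CoFib}^\omega,\mathrm{Fib}^\omega,\mathrm{Weq}^\omega)$ and $\Psi:(\mathrm{CoFib},\mathrm{Fib},\mathrm{Weq})\mapsto(\mathrm T\mathcal C,\mathcal F)$, where $\mathrm T\mathcal C$ is the class of trivially cofibrant objects and $\mathcal F$ the class of fibrant objects, are mutually inverse bijections between $S^C$ and $S^M$. -/

import Mathlib

open CategoryTheory CategoryTheory.Limits

universe v u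

namespace ExactCat

section Exact

variable {A : Type u} [Category.{v} A] [Preadditive A]

/-- `i` is the first morphism of a member `(i, d)` of a class `P` of short complexes. -/
def IsInflationOf (P : ObjectProperty (ShortComplex A)) {X Y : A} (i : X ⟶ Y) : Prop :=
  ∃ (Z : A) (d : Y ⟶ Z) (w : i ≫ d = 0), P (ShortComplex.mk i d w)

/-- `d` is the second morphism of a member `(i, d)` of a class `P` of short complexes. -/
def IsDeflationOf (P : ObjectProperty (ShortComplex A)) {Y Z : A} (d : Y ⟶ Z) : Prop :=
  ∃ (X : A) (i : X ⟶ Y) (w : i ≫ d = 0), P (ShortComplex.mk i d w)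

end Exact

open scoped ZeroObject in
/-- An exact structure (in Keller's axiomatization) on an additive category `A`, i.e. on a
preadditive category with a zero object and binary biproducts: a class of kernel-cokernel pairs,
called conflations, whose first (second) morphisms are called inflations (deflations). -/
structure ExactStructure (A : Type u) [Category.{v} A] [Preadditive A] [HasZeroObject A]
    [HasBinaryBiproducts A] where
  conflation : ObjectProperty (ShortComplex A)
  isKernel : ∀ S, conflation S → Nonempty (IsLimit (KernelFork.ofι S.f S.zero))
  isCokernel : ∀ S, conflation S → Nonempty (IsColimit (CokernelCofork.ofπ S.g S.zero))
  of_iso : ∀ ⦃S T : ShortComplex A⦄, (S ≅ T) → conflation S → conflation T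
  id_zero : IsDeflationOf conflation (𝟙 (0 : A))
  comp_deflation : ∀ ⦃X Y Z : A⦄ (d : X ⟶ Y) (e : Y ⟶ Z), IsDeflationOf conflation d →
    IsDeflationOf conflation e → IsDeflationOf conflation (d ≫ e)
  pullback_deflation : ∀ ⦃Y Z Z' : A⦄ (d : Y ⟶ Z) (f : Z' ⟶ Z), IsDeflationOf conflation d →
    ∃ (Y' : A) (f' : Y' ⟶ Y) (d' : Y' ⟶ Z'), IsPullback f' d' d f ∧ IsDeflationOf conflation d'
  pushout_inflation : ∀ ⦃X Y X' : A⦄ (i : X ⟶ Y) (f : X ⟶ X'), IsInflationOf conflation i →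
    ∃ (Y' : A) (i' : X' ⟶ Y') (f' : Y ⟶ Y'), IsPushout i f f' i' ∧ IsInflationOf conflation i'

/-- Weak idempotent completeness: every split epimorphism has a kernel. -/
def WeaklyIdempotentComplete (A : Type u) [Category.{v} A] [Preadditive A] : Prop :=
  ∀ ⦃Y Z : A⦄ (r : Y ⟶ Z), IsSplitEpi r → HasKernel r

/-- `ω` is covariantly finite: every object `M` has a left `ω`-approximation, that is, a morphism
`M ⟶ W` with `W` in `ω` through which every morphism from `M` to an object of `ω` factors. -/
def CovariantlyFinite {A : Type u} [Category.{v} A] (ω : ObjectProperty A) : Prop :=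
  ∀ M : A, ∃ (W : A) (f : M ⟶ W), ω W ∧
    ∀ ⦃W' : A⦄ (g : M ⟶ W'), ω W' → ∃ h : W ⟶ W', f ≫ h = g

/-- Three classes of morphisms: cofibrations, fibrations and weak equivalences. -/
@[ext]
structure MorphismTriple (A : Type u) [Category.{v} A] where
  cofib : MorphismProperty A
  fib : MorphismProperty A
  weq : MorphismProperty A

namespace MorphismTriple

variable {A : Type u} [Category.{v} A] (M : MorphismTriple A)

/-- The axioms of a (closed) model structure; no limits or colimits are required. -/
structure IsModelStructure : Prop where
  two_out_of_three : M.weq.HasTwoOutOfThreeProperty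
  retract_cofib : M.cofib.IsStableUnderRetracts
  retract_fib : M.fib.IsStableUnderRetracts
  retract_weq : M.weq.IsStableUnderRetracts
  lifting : ∀ ⦃X Y Z W : A⦄ (i : X ⟶ Y) (p : Z ⟶ W), M.cofib i → M.fib p →
    (M.weq i ∨ M.weq p) → HasLiftingProperty i p
  factor_trivial_cofib : ∀ ⦃X Y : A⦄ (f : X ⟶ Y), ∃ (Z : A) (i : X ⟶ Z) (p : Z ⟶ Y),
    M.cofib i ∧ M.weq i ∧ M.fib p ∧ i ≫ p = f
  factor_trivial_fib : ∀ ⦃X Y : A⦄ (f : X ⟶ Y), ∃ (Z : A) (j : X ⟶ Z) (q : Z ⟶ Y),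
    M.cofib j ∧ M.fib q ∧ M.weq q ∧ j ≫ q = f

variable [HasZeroMorphisms A] [HasZeroObject A]

open scoped ZeroObject

/-- The class of cofibrant objects. -/
def cofibrant : ObjectProperty A := fun X => M.cofib (0 : (0 : A) ⟶ X)

/-- The class of fibrant objects. -/
def fibrant : ObjectProperty A := fun X => M.fib (0 : X ⟶ (0 : A))

/-- The class of trivial objects. -/
def trivialObj : ObjectProperty A := fun X => M.weq (0 : (0 : A) ⟶ X)

/-- The class of trivially cofibrant objects. -/
def triviallyCofibrant : ObjectProperty A := fun X => M.cofibrant X ∧ M.trivialObj X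

/-- The pair (trivially cofibrant objects, fibrant objects). -/
def objectPair : ObjectProperty A × ObjectProperty A := (M.triviallyCofibrant, M.fibrant)

end MorphismTriple

namespace ExactStructure

variable {A : Type u} [Category.{v} A] [Preadditive A] [HasZeroObject A] [HasBinaryBiproducts A]
  (E : ExactStructure A)

/-- An extension of `X` by `Y`: a conflation `Y ⟶ mid ⟶ X`. -/
structure Extension (X Y : A) where
  mid : A
  i : Y ⟶ mid
  d : mid ⟶ X
  w : i ≫ d = 0
  conflation : E.conflation (ShortComplex.mk i d w)

/-- Equivalence of extensions: an isomorphism of the middle terms that is compatible with the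
identities at both ends. -/
def extensionSetoid (X Y : A) : Setoid (E.Extension X Y) where
  r S T := ∃ e : S.mid ≅ T.mid, S.i ≫ e.hom = T.i ∧ e.hom ≫ T.d = S.d
  iseqv :=
    { refl := fun S => ⟨Iso.refl _, by simp, by simp⟩
      symm := by
        rintro S T ⟨e, h₁, h₂⟩
        exact ⟨e.symm, by simp [← h₁], by simp [← h₂]⟩
      trans := by
        rintro S T U ⟨e, h₁, h₂⟩ ⟨e', h₁', h₂'⟩
        exact ⟨e ≪≫ e', by simp [← h₁', ← h₁], by simp [h₂', h₂]⟩ }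

/-- The underlying set of the Yoneda extension group `Ext¹(X, Y)`. -/
def Ext1 (X Y : A) : Type (max u v) := Quotient (E.extensionSetoid X Y)

/-- `Ext¹(X, Y) = 0`. The zero of the group `Ext¹(X, Y)` is the class of the split extension, so
the group vanishes iff its underlying set has at most one element. -/
def Ext1Vanishes (X Y : A) : Prop := Subsingleton (E.Ext1 X Y)

/-- Cotorsion pairs: `𝒳 = {X | Ext¹(X, 𝒴) = 0}` and `𝒴 = {Y | Ext¹(𝒳, Y) = 0}`. -/
def IsCotorsionPair (𝒳 𝒴 : ObjectProperty A) : Prop :=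
  (∀ X, 𝒳 X ↔ ∀ Y, 𝒴 Y → E.Ext1Vanishes X Y) ∧ (∀ Y, 𝒴 Y ↔ ∀ X, 𝒳 X → E.Ext1Vanishes X Y)

/-- Completeness: every object `M` fits in conflations `Y ⟶ X ⟶ M` and `M ⟶ Y' ⟶ X'` with
`X, X'` in `𝒳` and `Y, Y'` in `𝒴`. -/
def IsCompletePair (𝒳 𝒴 : ObjectProperty A) : Prop :=
  ∀ M : A,
    (∃ (Y X : A) (i : Y ⟶ X) (d : X ⟶ M) (w : i ≫ d = 0),
      𝒴 Y ∧ 𝒳 X ∧ E.conflation (ShortComplex.mk i d w)) ∧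
    (∃ (Y' X' : A) (i : M ⟶ Y') (d : Y' ⟶ X') (w : i ≫ d = 0),
      𝒴 Y' ∧ 𝒳 X' ∧ E.conflation (ShortComplex.mk i d w))

/-- Heredity: `𝒳` is closed under kernels of deflations, `𝒴` under cokernels of inflations. -/
def IsHereditaryPair (𝒳 𝒴 : ObjectProperty A) : Prop :=
  (∀ S, E.conflation S → 𝒳 S.X₂ → 𝒳 S.X₃ → 𝒳 S.X₁) ∧
  (∀ S, E.conflation S → 𝒴 S.X₁ → 𝒴 S.X₂ → 𝒴 S.X₃)

/-- Inflations with cokernel in `𝒳`. -/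
def inflationsWithCokernel (𝒳 : ObjectProperty A) : MorphismProperty A := fun _ B f =>
  ∃ (C : A) (d : B ⟶ C) (w : f ≫ d = 0), E.conflation (ShortComplex.mk f d w) ∧ 𝒳 C

/-- Deflations with kernel in `𝒴`. -/
def deflationsWithKernel (𝒴 : ObjectProperty A) : MorphismProperty A := fun B _ f =>
  ∃ (K : A) (i : K ⟶ B) (w : i ≫ f = 0), E.conflation (ShortComplex.mk i f w) ∧ 𝒴 K

/-- The dual `ω`-model structure attached to a pair `(𝒳, 𝒴)`, with `ω = 𝒳 ∩ 𝒴`: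
cofibrations are the `ω`-monic morphisms, fibrations are the deflations with kernel in `𝒴`, and
`f : M ⟶ N` is a weak equivalence if for some `t : M ⟶ W` with `W` in `ω` the morphism
`(f, t) : M ⟶ N ⊞ W` is an inflation with cokernel in `𝒳`. -/
noncomputable def dualOmega (P : ObjectProperty A × ObjectProperty A) : MorphismTriple A where
  cofib := fun _ N f =>
    ∀ W : A, P.1 W → P.2 W → Function.Surjective (fun g : N ⟶ W => f ≫ g)
  fib := E.deflationsWithKernel P.2
  weq := fun M _ f => ∃ (W : A) (t : M ⟶ W), (P.1 W ∧ P.2 W) ∧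
    E.inflationsWithCokernel P.1 (biprod.lift f t)

/-- The class of hereditary complete cotorsion pairs `(𝒳, 𝒴)` whose core `𝒳 ∩ 𝒴` is
covariantly finite. -/
def cotorsionPairs : Set (ObjectProperty A × ObjectProperty A) :=
  {P | E.IsCotorsionPair P.1 P.2 ∧ E.IsCompletePair P.1 P.2 ∧ E.IsHereditaryPair P.1 P.2 ∧
    CovariantlyFinite (P.1 ⊓ P.2)}

/-- The class of weakly injective model structures: fibrations are precisely the deflations with
fibrant kernel, each trivial cofibration is an inflation, and each object is cofibrant. -/
def weaklyInjectiveModelStructures : Set (MorphismTriple A) :=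
  {M | M.IsModelStructure ∧
    M.fib = E.deflationsWithKernel M.fibrant ∧
    (∀ ⦃X Y : A⦄ (f : X ⟶ Y), M.cofib f → M.weq f → IsInflationOf E.conflation f) ∧
    ∀ X : A, M.cofibrant X}

end ExactStructure

end ExactCat

/-! Let `ω` be the core of a pair `(𝒳, 𝒴)`. As defined, the weak equivalences do not visibly satisfy
two-out-of-three. The key is that they are exactly the morphisms inducing bijections on Hom(-, Y)/ω
for every Y in 𝒴 (`dualOmega_weq_iff`); for this class two-out-of-three and stability under retracts
are formal. For the hard direction, write f as an inflation with cokernel in 𝒳 followed by a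
deflation with kernel in 𝒴. The deflation is again a stable equivalence, and heredity forces it to
split with kernel in `ω` (`exists_retraction_of_stableEquivalences`).

Hence trivial cofibrations are the inflations with cokernel in 𝒳, and trivial fibrations are the
split epimorphisms with kernel in `ω`. Lifting is then either Ext¹-vanishing or the definition of
`ω`-monic. One factorization comes from completeness; the other adds a left `ω`-approximation of the
source as a summand of the target. Weak idempotent completeness serves to split off summands, so as
to recognize deflations and inflations.

Conversely, in a weakly injective model structure lifting amounts to Ext¹-vanishing, and the
factorizations of 0 ⟶ X and X ⟶ 0 give completeness and approximations. As all objects are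
cofibrant, trivial fibrations split with kernel in the core, so the cofibrations are the `ω`-monic
morphisms. Cofibrations and fibrations determine the weak equivalences, so the two constructions are
inverse. -/

namespace ExactCat

/-- A split epimorphism is the projection of a direct sum decomposition. -/
lemma WeaklyIdempotentComplete.exists_splitting {A : Type u} [Category.{v} A]
    [Preadditive A] (hA : WeaklyIdempotentComplete A) {B C : A} (r : B ⟶ C) (s : C ⟶ B)
    (hs : s ≫ r = 𝟙 C) : ∃ (K : A) (k : K ⟶ B) (t : B ⟶ K),
      k ≫ t = 𝟙 K ∧ k ≫ r = 0 ∧ t ≫ k + r ≫ s = 𝟙 B := by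
  have := hA r ⟨⟨s, hs⟩⟩
  have ht : (𝟙 B - r ≫ s) ≫ r = 0 := by simp [hs]
  have e : kernel.lift r _ ht ≫ kernel.ι r = 𝟙 B - r ≫ s := kernel.lift_ι _ _ _
  refine ⟨kernel r, kernel.ι r, kernel.lift r _ ht, ?_, by simp, by simp⟩
  rw [← cancel_mono (kernel.ι r), Category.assoc, e]
  simp

/-! ### Calculus of conflations -/

namespace ExactStructure

open scoped ZeroObject

variable {A : Type u} [Category.{v} A] [Preadditive A] [HasZeroObject A] [HasBinaryBiproducts A]
  {E : ExactStructure A}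

variable (E) in
/-- The pair `(i, d)` is a conflation. -/
def IsConflation {X Y Z : A} (i : X ⟶ Y) (d : Y ⟶ Z) : Prop :=
  ∃ w : i ≫ d = 0, E.conflation (ShortComplex.mk i d w)

namespace IsConflation

variable {X Y Z : A} {i : X ⟶ Y} {d : Y ⟶ Z}

lemma w (h : E.IsConflation i d) : i ≫ d = 0 := h.1

lemma isDeflationOf (h : E.IsConflation i d) : IsDeflationOf E.conflation d := ⟨_, _, h.1, h.2⟩

lemma isInflationOf (h : E.IsConflation i d) : IsInflationOf E.conflation i := ⟨_, _, h.1, h.2⟩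

lemma mono (h : E.IsConflation i d) : Mono i :=
  Fork.IsLimit.mono (E.isKernel _ h.2).some

lemma epi (h : E.IsConflation i d) : Epi d :=
  Cofork.IsColimit.epi (E.isCokernel _ h.2).some

lemma exists_lift (h : E.IsConflation i d) {T : A} (x : T ⟶ Y) (hx : x ≫ d = 0) :
    ∃ l : T ⟶ X, l ≫ i = x :=
  let l := KernelFork.IsLimit.lift' (E.isKernel _ h.2).some x hx
  ⟨l.1, l.2⟩

lemma exists_desc (h : E.IsConflation i d) {T : A} (x : Y ⟶ T) (hx : i ≫ x = 0) :
    ∃ l : Z ⟶ T, d ≫ l = x :=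
  let l := CokernelCofork.IsColimit.desc' (E.isCokernel _ h.2).some x hx
  ⟨l.1, l.2⟩

lemma of_iso (h : E.IsConflation i d) {X' Y' Z' : A} {i' : X' ⟶ Y'} {d' : Y' ⟶ Z'}
    (e₁ : X ≅ X') (e₂ : Y ≅ Y') (e₃ : Z ≅ Z') (h₁ : e₁.hom ≫ i' = i ≫ e₂.hom)
    (h₂ : e₂.hom ≫ d' = d ≫ e₃.hom) : E.IsConflation i' d' := by
  have w' : i' ≫ d' = 0 := by
    rw [← cancel_epi e₁.hom, reassoc_of% h₁, h₂, reassoc_of% h.w]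
    simp
  exact ⟨w', E.of_iso (ShortComplex.isoMk (S₁ := .mk i d h.w) (S₂ := .mk i' d' w')
    e₁ e₂ e₃ h₁ h₂) h.2⟩

/-- A kernel of a deflation completes it to a conflation. -/
lemma of_kernel (h : E.IsConflation i d) {X' : A} (i' : X' ⟶ Y) [Mono i'] (w' : i' ≫ d = 0)
    (hl : ∀ ⦃T : A⦄ (x : T ⟶ Y), x ≫ d = 0 → ∃ l : T ⟶ X', l ≫ i' = x) :
    E.IsConflation i' d := by
  obtain ⟨a, ha⟩ := h.exists_lift i' w'
  obtain ⟨b, hb⟩ := hl i h.w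
  have := h.mono
  refine h.of_iso ⟨b, a, ?_, ?_⟩ (Iso.refl _) (Iso.refl _) (by simpa) (by simp)
  · rw [← cancel_mono i, Category.assoc, ha, hb, Category.id_comp]
  · rw [← cancel_mono i', Category.assoc, hb, ha, Category.id_comp]

/-- A cokernel of an inflation completes it to a conflation. -/
lemma of_cokernel (h : E.IsConflation i d) {Z' : A} (d' : Y ⟶ Z') [Epi d'] (w' : i ≫ d' = 0)
    (hl : ∀ ⦃T : A⦄ (x : Y ⟶ T), i ≫ x = 0 → ∃ l : Z' ⟶ T, d' ≫ l = x) :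
    E.IsConflation i d' := by
  obtain ⟨a, ha⟩ := h.exists_desc d' w'
  obtain ⟨b, hb⟩ := hl d h.w
  have := h.epi
  refine h.of_iso (Iso.refl _) (Iso.refl _) ⟨a, b, ?_, ?_⟩ (by simp) (by simpa using ha.symm)
  · rw [← cancel_epi d, reassoc_of% ha, hb, Category.comp_id]
  · rw [← cancel_epi d', reassoc_of% hb, ha, Category.comp_id]

/-- Pushouts of conflations are conflations with the same cokernel. -/
lemma of_isPushout (h : E.IsConflation i d) {X' Y' : A} {f : X ⟶ X'} {f' : Y ⟶ Y'} {i' : X' ⟶ Y'}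
    (sq : IsPushout i f f' i') : ∃ d' : Y' ⟶ Z, f' ≫ d' = d ∧ E.IsConflation i' d' := by
  obtain ⟨d', h₁, h₂⟩ := sq.exists_desc d (0 : X' ⟶ Z) (by simp [h.w])
  refine ⟨d', h₁, ?_⟩
  obtain ⟨Y'', i'', f'', sq', Q, q, w, hq⟩ := E.pushout_inflation i f h.isInflationOf
  have := h.epi
  have : Epi d' := epi_of_epi_fac h₁
  let e := sq'.isoIsPushout _ _ sq
  have hi : E.IsConflation i' (e.inv ≫ q) :=
    of_iso ⟨w, hq⟩ (Iso.refl _) e (Iso.refl _)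
      (by simp [e]) (by simp)
  refine hi.of_cokernel d' h₂ fun T x hx => ?_
  obtain ⟨l, hl⟩ := h.exists_desc (f' ≫ x) (by rw [reassoc_of% sq.w, hx, comp_zero])
  exact ⟨l, sq.hom_ext (by rw [reassoc_of% h₁, hl]) (by rw [reassoc_of% h₂, hx, zero_comp])⟩

/-- Pullbacks of conflations are conflations with the same kernel. -/
lemma of_isPullback (h : E.IsConflation i d) {Y' Z' : A} {f : Z' ⟶ Z} {f' : Y' ⟶ Y} {d' : Y' ⟶ Z'}
    (sq : IsPullback f' d' d f) : ∃ i' : X ⟶ Y', i' ≫ f' = i ∧ E.IsConflation i' d' := by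
  obtain ⟨i', h₁, h₂⟩ := sq.exists_lift i (0 : X ⟶ Z') (by simp [h.w])
  refine ⟨i', h₁, ?_⟩
  obtain ⟨Y'', f'', d'', sq', Q, q, w, hq⟩ := E.pullback_deflation d f h.isDeflationOf
  have := h.mono
  have : Mono i' := mono_of_mono_fac h₁
  let e := sq'.isoIsPullback _ _ sq
  have hi : E.IsConflation (q ≫ e.hom) d' :=
    of_iso ⟨w, hq⟩ (Iso.refl _) e (Iso.refl _)
      (by simp) (by simp [e])
  refine hi.of_kernel i' h₂ fun T x hx => ?_
  obtain ⟨l, hl⟩ := h.exists_lift (x ≫ f') (by rw [Category.assoc, sq.w, reassoc_of% hx, zero_comp])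
  exact ⟨l, sq.hom_ext (by rw [Category.assoc, h₁, hl]) (by rw [Category.assoc, h₂, hx, comp_zero])⟩

lemma exists_pushout (h : E.IsConflation i d) {X' : A} (f : X ⟶ X') :
    ∃ (Y' : A) (f' : Y ⟶ Y') (i' : X' ⟶ Y') (d' : Y' ⟶ Z), IsPushout i f f' i' ∧
      f' ≫ d' = d ∧ E.IsConflation i' d' := by
  obtain ⟨Y', i', f', sq, -⟩ := E.pushout_inflation i f h.isInflationOf
  obtain ⟨d', h₁, h₂⟩ := h.of_isPushout sq
  exact ⟨Y', f', i', d', sq, h₁, h₂⟩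

lemma exists_pullback (h : E.IsConflation i d) {Z' : A} (f : Z' ⟶ Z) :
    ∃ (Y' : A) (f' : Y' ⟶ Y) (d' : Y' ⟶ Z') (i' : X ⟶ Y'), IsPullback f' d' d f ∧
      i' ≫ f' = i ∧ E.IsConflation i' d' := by
  obtain ⟨Y', f', d', sq, -⟩ := E.pullback_deflation d f h.isDeflationOf
  obtain ⟨i', h₁, h₂⟩ := h.of_isPullback sq
  exact ⟨Y', f', d', i', sq, h₁, h₂⟩

end IsConflation

lemma exists_isConflation_of_isDeflationOf {Y Z : A} {d : Y ⟶ Z}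
    (h : IsDeflationOf E.conflation d) : ∃ (X : A) (i : X ⟶ Y), E.IsConflation i d :=
  let ⟨X, i, w, h⟩ := h
  ⟨X, i, w, h⟩

lemma exists_isConflation_of_isInflationOf {X Y : A} {i : X ⟶ Y}
    (h : IsInflationOf E.conflation i) : ∃ (Z : A) (d : Y ⟶ Z), E.IsConflation i d :=
  let ⟨Z, d, w, h⟩ := h
  ⟨Z, d, w, h⟩

variable (E)

lemma isConflation_zero : E.IsConflation (𝟙 (0 : A)) (0 : (0 : A) ⟶ 0) := by
  obtain ⟨X, i, w, h⟩ := E.id_zero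
  have hi : E.IsConflation i (𝟙 (0 : A)) := ⟨w, h⟩
  have := hi.mono
  have hX : IsZero X := by
    rw [IsZero.iff_id_eq_zero, ← cancel_mono i]
    exact (isZero_zero A).eq_of_tgt _ _
  exact hi.of_iso hX.isoZero (Iso.refl _) (Iso.refl _)
    ((isZero_zero A).eq_of_tgt _ _) ((isZero_zero A).eq_of_tgt _ _)

lemma isConflation_id_zero (X : A) : E.IsConflation (𝟙 X) (0 : X ⟶ 0) := by
  obtain ⟨d', -, h⟩ := E.isConflation_zero.of_isPushout
    (f := (0 : (0 : A) ⟶ X)) (f' := 0) (i' := 𝟙 X)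
    (IsPushout.mk' (by simp) (fun _ _ _ _ h => by simpa using h)
      (fun _ a b _ => ⟨b, (isZero_zero A).eq_of_src _ _, by simp⟩))
  rwa [(isZero_zero A).eq_of_tgt d' 0] at h

lemma isConflation_zero_id (X : A) : E.IsConflation (0 : 0 ⟶ X) (𝟙 X) := by
  obtain ⟨i', -, h⟩ := E.isConflation_zero.of_isPullback
    (f := (0 : X ⟶ (0 : A))) (f' := 0) (d' := 𝟙 X)
    (IsPullback.mk' (by simp) (fun _ _ _ _ h => by simpa using h)
      (fun _ a b _ => ⟨b, (isZero_zero A).eq_of_tgt _ _, by simp⟩))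
  rwa [(isZero_zero A).eq_of_src i' 0] at h

/-- Split short exact sequences are conflations. -/
lemma isConflation_of_split {K B C : A} {k : K ⟶ B} {r : B ⟶ K} {d : B ⟶ C} {s : C ⟶ B}
    (hkr : k ≫ r = 𝟙 K) (hsd : s ≫ d = 𝟙 C) (hkd : k ≫ d = 0) (h : r ≫ k + d ≫ s = 𝟙 B) :
    E.IsConflation k d := by
  have hsr : s ≫ r = 0 := by
    have : s ≫ (r ≫ k + d ≫ s) ≫ r = s ≫ r := by rw [h, Category.id_comp]
    simpa [hkr, reassoc_of% hsd] using this
  obtain ⟨i', h₁, h₂⟩ := (E.isConflation_id_zero K).of_isPullback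
    (f := (0 : C ⟶ (0 : A))) (f' := r) (d' := d)
    (IsPullback.mk' (by simp) (fun T a b h₁ h₂ => by
        rw [← Category.comp_id a, ← Category.comp_id b, ← h]
        simp [reassoc_of% h₁, reassoc_of% h₂])
      (fun _ a b _ => ⟨a ≫ k + b ≫ s, by simp [hkr, hsr], by simp [hsd, hkd]⟩))
  have : k = i' := by
    rw [← Category.comp_id k, ← Category.comp_id i', ← h]
    simp [reassoc_of% h₁, reassoc_of% hkd, reassoc_of% h₂.w, reassoc_of% hkr]
  rwa [this]

lemma isConflation_biprod (X Y : A) : E.IsConflation (biprod.inl : X ⟶ X ⊞ Y) biprod.snd :=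
  E.isConflation_of_split biprod.inl_fst biprod.inr_snd biprod.inl_snd biprod.total

lemma isConflation_biprod' (X Y : A) : E.IsConflation (biprod.inr : Y ⟶ X ⊞ Y) biprod.fst :=
  E.isConflation_of_split biprod.inr_snd biprod.inl_fst biprod.inr_fst
    ((add_comm _ _).trans biprod.total)

variable {E}

/-- Adding an identity to a conflation. -/
lemma IsConflation.biprod_id {X Y Z : A} {i : X ⟶ Y} {d : Y ⟶ Z} (h : E.IsConflation i d) (T : A) :
    E.IsConflation (i ≫ biprod.inl) (biprod.map d (𝟙 T)) := by
  obtain ⟨i', h₁, h₂⟩ := h.of_isPullback (f := (biprod.fst : Z ⊞ T ⟶ Z)) (f' := biprod.fst)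
    (d' := biprod.map d (𝟙 T))
    (IsPullback.mk' (by simp) (fun T a b h₁ h₂ => by
        ext
        · exact h₁
        · simpa using h₂ =≫ biprod.snd)
      (fun _ a b hab => ⟨biprod.lift a (b ≫ biprod.snd), by simp, by
        ext
        · simpa using hab
        · simp⟩))
  have : i ≫ biprod.inl = i' := by
    ext
    · simp [h₁]
    · simpa using (h₂.w =≫ biprod.snd).symm
  rwa [this]

lemma isDeflationOf_iso_comp {X Y Z : A} (e : X ≅ Y) {d : Y ⟶ Z}
    (h : IsDeflationOf E.conflation d) : IsDeflationOf E.conflation (e.hom ≫ d) := by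
  obtain ⟨K, k, hk⟩ := exists_isConflation_of_isDeflationOf h
  exact (hk.of_iso (i' := k ≫ e.inv) (d' := e.hom ≫ d) (Iso.refl _) e.symm (Iso.refl _)
    (by simp) (by simp)).isDeflationOf

/-- A morphism with a kernel is a deflation if it becomes one after adding a zero summand. -/
lemma IsConflation.of_fst_comp {B A' C K : A} {g : B ⟶ C} {k : K ⟶ B} [Mono k] (w : k ≫ g = 0)
    (hk : ∀ ⦃T : A⦄ (x : T ⟶ B), x ≫ g = 0 → ∃ l : T ⟶ K, l ≫ k = x)
    (h : IsDeflationOf E.conflation ((biprod.fst : B ⊞ A' ⟶ B) ≫ g)) : E.IsConflation k g := by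
  obtain ⟨N, n, hn⟩ := exists_isConflation_of_isDeflationOf h
  have : Mono (biprod.map k (𝟙 A')) := ⟨fun a b hab => by
    ext
    · rw [← cancel_mono k]
      simpa using hab =≫ biprod.fst
    · simpa using hab =≫ biprod.snd⟩
  have hN : E.IsConflation (biprod.map k (𝟙 A')) (biprod.fst ≫ g) :=
    hn.of_kernel _ (by simp [w]) fun T x hx => by
      obtain ⟨l, hl⟩ := hk (x ≫ biprod.fst) (by simpa using hx)
      exact ⟨biprod.lift l (x ≫ biprod.snd), by ext <;> simp [hl]⟩
  -- The kernel of `fst ≫ g` is `k ⊞ 𝟙`, and its pushout along the projection `K ⊞ A' ⟶ K` is `k`.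
  obtain ⟨d', h₁, h₂⟩ := hN.of_isPushout (f := biprod.fst) (f' := biprod.fst) (i' := k)
    (IsPushout.mk' (by simp) (fun T a b h _ => by simpa using biprod.inl ≫= h)
      (fun T a b hab => by
        have h₁ : k ≫ biprod.inl ≫ a = b := by simpa using biprod.inl ≫= hab
        have h₂ : biprod.inr ≫ a = 0 := by simpa using biprod.inr ≫= hab
        exact ⟨biprod.inl ≫ a, by ext <;> simp [h₂], h₁⟩))
  have : d' = g := by simpa using biprod.inl ≫= h₁
  rwa [← this]

/-- Adding a morphism to a deflation gives a deflation from the biproduct. -/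
lemma isDeflationOf_desc {B A' C : A} (g : B ⟶ C) {d : A' ⟶ C}
    (h : IsDeflationOf E.conflation d) : IsDeflationOf E.conflation (biprod.desc d g) := by
  obtain ⟨K, k, hk⟩ := exists_isConflation_of_isDeflationOf h
  let e : C ⊞ B ≅ C ⊞ B :=
    { hom := biprod.lift (biprod.desc (𝟙 C) g) biprod.snd
      inv := biprod.lift (biprod.desc (𝟙 C) (-g)) biprod.snd
      hom_inv_id := by ext <;> simp
      inv_hom_id := by ext <;> simp }
  have := E.comp_deflation _ _ (hk.biprod_id B).isDeflationOf
    (isDeflationOf_iso_comp e (E.isConflation_biprod' C B).isDeflationOf)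
  have e' : biprod.map d (𝟙 B) ≫ e.hom ≫ biprod.fst = biprod.desc d g := by
    ext <;> simp [e]
  rwa [e'] at this

/-- Noether's isomorphism theorem for a composite of inflations `i ≫ j`: its cokernel is the pushout
of `j` along the cokernel of `i`. -/
lemma IsConflation.comp {X Y Z C V : A} {i : X ⟶ Y} {d : Y ⟶ C} (hi : E.IsConflation i d)
    {j : Y ⟶ Z} {Q : A} {q : Z ⟶ Q} (hj : E.IsConflation j q) {d' : Z ⟶ V} {j' : C ⟶ V}
    (sq : IsPushout j d d' j') : E.IsConflation (i ≫ j) d' := by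
  obtain ⟨q', hq', hj'⟩ := hj.of_isPushout sq
  have := hi.mono
  have := hj.mono
  have := hj'.mono
  refine IsConflation.of_fst_comp (A' := Y)
    (by rw [Category.assoc, sq.w, reassoc_of% hi.w, zero_comp])
    (fun T x hx => ?_) ?_
  · obtain ⟨l, hl⟩ := hj.exists_lift x (by rw [← hq', reassoc_of% hx, zero_comp])
    obtain ⟨m, hm⟩ := hi.exists_lift l
      (by rw [← cancel_mono j', Category.assoc, ← sq.w, reassoc_of% hl, hx, zero_comp])
    exact ⟨m, by rw [reassoc_of% hm, hl]⟩
  · -- the pullback of `q` along `q'` is `Z ⊞ C`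
    have sq' : IsPullback (biprod.desc d' j') biprod.fst q' q :=
      IsPullback.mk' (by ext <;> simp [hq', hj'.w]) (fun T a b h₁ h₂ => by
          ext
          · exact h₂
          · rw [← cancel_mono j']
            rw [biprod.desc_eq, Preadditive.comp_add, Preadditive.comp_add, reassoc_of% h₂] at h₁
            simpa using h₁)
        (fun T a b hab => by
          obtain ⟨l, hl⟩ := hj'.exists_lift (a - b ≫ d') (by simp [hab, hq'])
          exact ⟨biprod.lift b l, by simp [hl], by simp⟩)
    obtain ⟨K, k, hk⟩ : ∃ (K : A) (k : K ⟶ Z ⊞ C), E.IsConflation k (biprod.desc d' j') := by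
      obtain ⟨_, _, hK⟩ := hj.of_isPullback sq'.flip
      exact ⟨_, _, hK⟩
    -- The shear (z, y) ↦ (z - jy, y) exhibits `fst ≫ d'` as a composite of deflations, because d'(z
    -- - jy) + j'(dy) = d'z.
    let e : Z ⊞ Y ≅ Z ⊞ Y :=
      { hom := biprod.lift (biprod.desc (𝟙 Z) (-j)) biprod.snd
        inv := biprod.lift (biprod.desc (𝟙 Z) j) biprod.snd
        hom_inv_id := by ext <;> simp
        inv_hom_id := by ext <;> simp }
    let b : Z ⊞ Y ≅ Y ⊞ Z := biprod.braiding _ _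
    let b' : C ⊞ Z ≅ Z ⊞ C := biprod.braiding _ _
    have := isDeflationOf_iso_comp (e ≪≫ b) (E.comp_deflation _ _ (hi.biprod_id Z).isDeflationOf
      (isDeflationOf_iso_comp b' hk.isDeflationOf))
    have e' : (e ≪≫ b).hom ≫ biprod.map d (𝟙 Z) ≫ b'.hom ≫ biprod.desc d' j' =
        biprod.fst ≫ d' := by
      ext <;> simp [e, b, b', sq.w]
    rwa [e'] at this

lemma IsConflation.exists_comp {X Y Z C Q : A} {i : X ⟶ Y} {d : Y ⟶ C} (hi : E.IsConflation i d)
    {j : Y ⟶ Z} {q : Z ⟶ Q} (hj : E.IsConflation j q) :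
    ∃ (V : A) (d' : Z ⟶ V), E.IsConflation (i ≫ j) d' := by
  obtain ⟨V, d', j', -, sq, -⟩ := hj.exists_pushout d
  exact ⟨V, d', hi.comp hj sq⟩

lemma exists_isConflation_of_splitEpi (hA : WeaklyIdempotentComplete A) {B C : A} (r : B ⟶ C)
    (s : C ⟶ B) (hs : s ≫ r = 𝟙 C) : ∃ (K : A) (k : K ⟶ B) (t : B ⟶ K), E.IsConflation k r ∧
      k ≫ t = 𝟙 K ∧ t ≫ k + r ≫ s = 𝟙 B :=
  let ⟨K, k, t, h₁, h₂, h₃⟩ := hA.exists_splitting r s hs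
  ⟨K, k, t, E.isConflation_of_split h₁ hs h₂ h₃, h₁, h₃⟩

/-- In a weakly idempotent complete exact category, `g` is a deflation if `f ≫ g` is. -/
lemma isDeflationOf_of_comp (hA : WeaklyIdempotentComplete A) {X B C : A} (f : X ⟶ B) (g : B ⟶ C)
    (h : IsDeflationOf E.conflation (f ≫ g)) : IsDeflationOf E.conflation g := by
  have hd : IsDeflationOf E.conflation ((biprod.fst : B ⊞ X ⟶ B) ≫ g) := by
    -- The isomorphism (b, x) ↦ (x, b - fx) turns the deflation `(f ≫ g, g)` into `fst ≫ g`.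
    let e : B ⊞ X ≅ X ⊞ B :=
      { hom := biprod.lift biprod.snd (biprod.desc (𝟙 B) (-f))
        inv := biprod.lift (biprod.desc f (𝟙 B)) biprod.fst
        hom_inv_id := by ext <;> simp
        inv_hom_id := by ext <;> simp }
    have := isDeflationOf_iso_comp e (isDeflationOf_desc g h)
    have e' : e.hom ≫ biprod.desc (f ≫ g) g = biprod.fst ≫ g := by ext <;> simp [e]
    rwa [e'] at this
  obtain ⟨N, n, hn⟩ := exists_isConflation_of_isDeflationOf hd
  obtain ⟨s, hs⟩ := hn.exists_lift (biprod.inr : X ⟶ B ⊞ X) (by simp)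
  -- `X` is a summand of the kernel `N` of `fst ≫ g`; splitting it off leaves a kernel of `g`.
  obtain ⟨K, k, t, h₁, h₂, h₃⟩ := hA.exists_splitting (n ≫ biprod.snd) s (by simp [reassoc_of% hs])
  have hsnd : k ≫ n ≫ biprod.snd = 0 := h₂
  have := hn.mono
  have : Mono (k ≫ n ≫ biprod.fst) := Preadditive.mono_of_cancel_zero _ fun x hx => by
    have : (x ≫ k) ≫ n = 0 := by
      ext
      · simpa using hx
      · simp [hsnd]
    have hxk : x ≫ k = 0 := by rwa [← cancel_mono n, zero_comp]
    rw [← Category.comp_id x, ← h₁, reassoc_of% hxk, zero_comp]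
  refine (IsConflation.of_fst_comp (k := k ≫ n ≫ biprod.fst) (by simpa using k ≫= hn.w)
    (fun T x hx => ?_) hd).isDeflationOf
  obtain ⟨l, hl⟩ := hn.exists_lift (x ≫ biprod.inl) (by simpa using hx)
  refine ⟨l ≫ t, ?_⟩
  have e : l ≫ t ≫ k = l := by
    have : l ≫ (t ≫ k + (n ≫ biprod.snd) ≫ s) = l := by rw [h₃, Category.comp_id]
    simpa [reassoc_of% hl] using this
  simp [reassoc_of% e, reassoc_of% hl]

/-- In a weakly idempotent complete exact category, `i` is an inflation if `(i, 0)` is. -/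
lemma exists_isConflation_of_lift_zero (hA : WeaklyIdempotentComplete A) {X B C : A}
    {i : X ⟶ B} {Q : A} {q : B ⊞ C ⟶ Q}
    (h : E.IsConflation (biprod.lift i 0) q) :
    ∃ (K : A) (d : B ⟶ K), E.IsConflation i d ∧ Nonempty (Retract K Q) := by
  obtain ⟨r, hr⟩ := h.exists_desc biprod.snd (by simp)
  obtain ⟨K, k, t, h₁, h₂, h₃⟩ := hA.exists_splitting r (biprod.inr ≫ q) (by simp [hr])
  have hk : biprod.inl ≫ q ≫ t ≫ k = biprod.inl ≫ q := by
    have : biprod.inl ≫ q ≫ (t ≫ k + r ≫ biprod.inr ≫ q) = biprod.inl ≫ q := by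
      rw [h₃, Category.comp_id]
    simpa [reassoc_of% hr] using this
  have : Mono k := mono_of_mono_fac h₁
  -- `C` splits off `Q` with complement `K`, and the pullback of `q` along `K ⟶ Q` is the summand
  -- `B`.
  obtain ⟨i', hi', hc⟩ := h.of_isPullback (f := k) (f' := biprod.inl)
    (d' := biprod.inl ≫ q ≫ t)
    (IsPullback.mk' (by simp [hk]) (fun T a b h _ => by simpa using h =≫ biprod.fst)
      (fun T a b hab => by
        have hs : a ≫ biprod.snd = 0 := by
          rw [← hr, reassoc_of% hab, h₂, comp_zero]
        have ha : (a ≫ biprod.fst) ≫ biprod.inl = a := by ext <;> simp [hs]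
        refine ⟨a ≫ biprod.fst, ha, ?_⟩
        rw [← cancel_mono k, ← hab]
        simp only [Category.assoc, hk]
        rw [← Category.assoc, ← Category.assoc, ha]))
  have : i' = i := by simpa using hi' =≫ biprod.fst
  exact ⟨K, _, this ▸ hc, ⟨⟨k, t, h₁⟩⟩⟩

end ExactStructure

end ExactCat

/-! ### Ext¹-vanishing, lifting and cotorsion pairs -/

namespace ExactCat

namespace ExactStructure

open scoped ZeroObject

variable {A : Type u} [Category.{v} A] [Preadditive A] [HasZeroObject A] [HasBinaryBiproducts A]
  {E : ExactStructure A}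

lemma IsConflation.exists_retraction_of_section {Y M X : A} {i : Y ⟶ M} {d : M ⟶ X}
    (h : E.IsConflation i d) {s : X ⟶ M} (hs : s ≫ d = 𝟙 X) :
    ∃ r : M ⟶ Y, i ≫ r = 𝟙 Y ∧ r ≫ i + d ≫ s = 𝟙 M := by
  obtain ⟨r, hr⟩ := h.exists_lift (𝟙 M - d ≫ s) (by simp [hs])
  have := h.mono
  refine ⟨r, ?_, by simp [hr]⟩
  rw [← cancel_mono i, Category.assoc, hr]
  simp [reassoc_of% h.w]

lemma IsConflation.exists_section_of_retraction {Y M X : A} {i : Y ⟶ M} {d : M ⟶ X}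
    (h : E.IsConflation i d) {r : M ⟶ Y} (hr : i ≫ r = 𝟙 Y) :
    ∃ s : X ⟶ M, s ≫ d = 𝟙 X ∧ r ≫ i + d ≫ s = 𝟙 M := by
  obtain ⟨s, hs⟩ := h.exists_desc (𝟙 M - r ≫ i) (by simp [reassoc_of% hr])
  have := h.epi
  refine ⟨s, ?_, by simp [hs]⟩
  rw [← cancel_epi d, reassoc_of% hs]
  simp [h.w]

lemma Ext1Vanishes.exists_retraction {X Y : A} (hE : E.Ext1Vanishes X Y) {M : A} {i : Y ⟶ M}
    {d : M ⟶ X} (h : E.IsConflation i d) : ∃ r : M ⟶ Y, i ≫ r = 𝟙 Y := by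
  have hb := E.isConflation_biprod Y X
  obtain ⟨e, he, -⟩ := Quotient.exact (hE.elim
    (Quotient.mk (E.extensionSetoid X Y) ⟨M, i, d, h.1, h.2⟩)
    (Quotient.mk (E.extensionSetoid X Y) ⟨_, _, _, hb.1, hb.2⟩))
  dsimp at e he
  exact ⟨e.hom ≫ biprod.fst, by simp [reassoc_of% he]⟩

lemma ext1Vanishes_of_section {X Y : A} (H : ∀ ⦃M : A⦄ (i : Y ⟶ M) (d : M ⟶ X),
    E.IsConflation i d → ∃ s : X ⟶ M, s ≫ d = 𝟙 X) : E.Ext1Vanishes X Y := by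
  refine ⟨fun a b => ?_⟩
  induction a using Quotient.inductionOn with | _ S
  induction b using Quotient.inductionOn with | _ T
  have hS : E.IsConflation S.i S.d := ⟨S.w, S.conflation⟩
  have hT : E.IsConflation T.i T.d := ⟨T.w, T.conflation⟩
  obtain ⟨s, hs⟩ := H _ _ hS
  obtain ⟨t, ht⟩ := H _ _ hT
  obtain ⟨r, hr, hrs⟩ := hS.exists_retraction_of_section hs
  obtain ⟨q, hq, hqt⟩ := hT.exists_retraction_of_section ht
  have := hS.mono
  have := hT.mono
  have hsr : s ≫ r = 0 := by
    rw [← cancel_mono S.i, Category.assoc, eq_sub_of_add_eq hrs]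
    simp [reassoc_of% hs]
  have htq : t ≫ q = 0 := by
    rw [← cancel_mono T.i, Category.assoc, eq_sub_of_add_eq hqt]
    simp [reassoc_of% ht]
  -- Both middle terms are identified with `Y ⊞ X` by their splittings.
  refine Quotient.sound ⟨⟨r ≫ T.i + S.d ≫ t, q ≫ S.i + T.d ≫ s, ?_, ?_⟩, ?_, ?_⟩
  · simp [reassoc_of% hq, reassoc_of% ht, reassoc_of% htq, reassoc_of% T.w, hrs]
  · simp [reassoc_of% hr, reassoc_of% hs, reassoc_of% hsr, reassoc_of% S.w, hqt]
  · simp [reassoc_of% hr, reassoc_of% S.w]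
  · simp [T.w, ht]

/-- Morphisms to `Y` extend along inflations whose cokernel `C` satisfies `Ext¹(C, Y) = 0`. -/
lemma Ext1Vanishes.exists_extension {X B C Y : A} (hE : E.Ext1Vanishes C Y) {i : X ⟶ B} {d : B ⟶ C}
    (h : E.IsConflation i d) (f : X ⟶ Y) : ∃ g : B ⟶ Y, i ≫ g = f := by
  obtain ⟨P, f', i', d', sq, -, h'⟩ := h.exists_pushout f
  obtain ⟨r, hr⟩ := hE.exists_retraction h'
  exact ⟨f' ≫ r, by rw [reassoc_of% sq.w, hr, Category.comp_id]⟩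

/-- Morphisms from `X` lift along deflations whose kernel `K` satisfies `Ext¹(X, K) = 0`. -/
lemma Ext1Vanishes.exists_lift {K B C X : A} (hE : E.Ext1Vanishes X K) {i : K ⟶ B} {d : B ⟶ C}
    (h : E.IsConflation i d) (f : X ⟶ C) : ∃ g : X ⟶ B, g ≫ d = f := by
  obtain ⟨P, f', d', i', sq, -, h'⟩ := h.exists_pullback f
  obtain ⟨r, hr⟩ := hE.exists_retraction h'
  obtain ⟨s, hs, -⟩ := h'.exists_section_of_retraction hr
  exact ⟨s ≫ f', by rw [Category.assoc, sq.w, reassoc_of% hs]⟩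

/-- An inflation with cokernel `C` lifts against a deflation with kernel `K` if
`Ext¹(C, K) = 0`. -/
lemma Ext1Vanishes.hasLiftingProperty {X B C K Z W : A} (hE : E.Ext1Vanishes C K) {i : X ⟶ B}
    {d : B ⟶ C} (hi : E.IsConflation i d) {k : K ⟶ Z} {p : Z ⟶ W} (hp : E.IsConflation k p) :
    HasLiftingProperty i p := by
  refine ⟨fun {u v} sq => ?_⟩
  obtain ⟨P, v', p', k', sqP, hk', hp'⟩ := hp.exists_pullback v
  obtain ⟨j, hj₁, hj₂⟩ := sqP.exists_lift u i sq.w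
  have := hi.mono
  have := hp'.mono
  have := hp'.epi
  -- What is needed is a section of `p'` whose restriction along `i` is `j`. The sequence `K ⊞ X ⟶ P
  -- ⟶ C` is a conflation; extending the projection onto `K` along it gives a retraction of `k'`
  -- that kills `j`, and the complementary section restricts to `j`.
  have hm : Mono (biprod.desc k' j) := Preadditive.mono_of_cancel_zero _ fun x hx => by
    rw [biprod.desc_eq, Preadditive.comp_add] at hx
    have h₂ : x ≫ biprod.snd = 0 := by
      rw [← cancel_mono i]
      simpa [hp'.w, hj₂] using hx =≫ p'
    have h₁ : x ≫ biprod.fst = 0 := by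
      rw [reassoc_of% h₂, zero_comp, add_zero] at hx
      rw [← cancel_mono k', zero_comp, Category.assoc, hx]
    ext <;> simp [h₁, h₂]
  obtain ⟨N, n, hn⟩ := exists_isConflation_of_isDeflationOf
    (E.comp_deflation _ _ hp'.isDeflationOf hi.isDeflationOf)
  have hc : E.IsConflation (biprod.desc k' j) (p' ≫ d) := by
    refine hn.of_kernel _ (by ext <;> simp [reassoc_of% hp'.w, reassoc_of% hj₂, hi.w])
      fun T x hx => ?_
    obtain ⟨a, ha⟩ := hi.exists_lift (x ≫ p') (by simpa using hx)
    obtain ⟨b, hb⟩ := hp'.exists_lift (x - a ≫ j) (by simp [hj₂, ha])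
    exact ⟨biprod.lift b a, by simp [hb]⟩
  obtain ⟨r, hr⟩ := hE.exists_extension hc (biprod.fst : K ⊞ X ⟶ K)
  have hr₁ : k' ≫ r = 𝟙 K := by simpa using biprod.inl ≫= hr
  have hr₂ : j ≫ r = 0 := by simpa using biprod.inr ≫= hr
  obtain ⟨s, hs₁, hs₂⟩ := hp'.exists_section_of_retraction hr₁
  have hjs : i ≫ s = j := by
    rw [← hj₂, Category.assoc, ← sub_eq_iff_eq_add'.2 hs₂.symm]
    simp [reassoc_of% hr₂]
  exact ⟨⟨⟨s ≫ v', by rw [reassoc_of% hjs, hj₁], by rw [Category.assoc, sqP.w, reassoc_of% hs₁]⟩⟩⟩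

lemma Ext1Vanishes.of_retract_left {X X' Y : A} (hE : E.Ext1Vanishes X' Y) (h : Retract X X') :
    E.Ext1Vanishes X Y :=
  ext1Vanishes_of_section fun M i d hc => by
    obtain ⟨l, hl⟩ := hE.exists_lift hc h.r
    exact ⟨h.i ≫ l, by simp [hl]⟩

lemma Ext1Vanishes.of_retract_right {X Y Y' : A} (hE : E.Ext1Vanishes X Y') (h : Retract Y Y') :
    E.Ext1Vanishes X Y :=
  ext1Vanishes_of_section fun M i d hc => by
    obtain ⟨l, hl⟩ := hE.exists_extension hc h.i
    obtain ⟨s, hs, -⟩ := hc.exists_section_of_retraction (r := l ≫ h.r) (by simp [reassoc_of% hl])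
    exact ⟨s, hs⟩

lemma inflationsWithCokernel_iff {𝒳 : ObjectProperty A} {X Y : A} {f : X ⟶ Y} :
    E.inflationsWithCokernel 𝒳 f ↔ ∃ (C : A) (d : Y ⟶ C), E.IsConflation f d ∧ 𝒳 C :=
  ⟨fun ⟨C, d, w, h, hC⟩ => ⟨C, d, ⟨w, h⟩, hC⟩, fun ⟨C, d, ⟨w, h⟩, hC⟩ => ⟨C, d, w, h, hC⟩⟩

lemma deflationsWithKernel_iff {𝒴 : ObjectProperty A} {X Y : A} {f : X ⟶ Y} :
    E.deflationsWithKernel 𝒴 f ↔ ∃ (K : A) (i : K ⟶ X), E.IsConflation i f ∧ 𝒴 K :=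
  ⟨fun ⟨C, d, w, h, hC⟩ => ⟨C, d, ⟨w, h⟩, hC⟩, fun ⟨C, d, ⟨w, h⟩, hC⟩ => ⟨C, d, w, h, hC⟩⟩

namespace IsCotorsionPair

variable {𝒳 𝒴 : ObjectProperty A} (h : E.IsCotorsionPair 𝒳 𝒴)

include h

lemma ext1Vanishes {X Y : A} (hX : 𝒳 X) (hY : 𝒴 Y) : E.Ext1Vanishes X Y := (h.1 X).1 hX Y hY

lemma left_of_retract {X X' : A} (hX' : 𝒳 X') (r : Retract X X') : 𝒳 X :=
  (h.1 X).2 fun _ hY => (h.ext1Vanishes hX' hY).of_retract_left r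

lemma right_of_retract {Y Y' : A} (hY' : 𝒴 Y') (r : Retract Y Y') : 𝒴 Y :=
  (h.2 Y).2 fun _ hX => (h.ext1Vanishes hX hY').of_retract_right r

lemma left_zero : 𝒳 (0 : A) :=
  (h.1 _).2 fun _ _ => ext1Vanishes_of_section fun _ _ _ _ => ⟨0, (isZero_zero A).eq_of_tgt _ _⟩

lemma right_zero : 𝒴 (0 : A) :=
  (h.2 _).2 fun _ _ => ext1Vanishes_of_section fun M i d hd => by
    obtain ⟨s, hs, -⟩ := hd.exists_section_of_retraction (r := 0)
      ((isZero_zero A).eq_of_tgt _ _)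
    exact ⟨s, hs⟩

lemma hasLiftingProperty {X Y Z W : A} {i : X ⟶ Y} {p : Z ⟶ W} (hi : E.inflationsWithCokernel 𝒳 i)
    (hp : E.deflationsWithKernel 𝒴 p) : HasLiftingProperty i p := by
  obtain ⟨C, d, hd, hC⟩ := inflationsWithCokernel_iff.1 hi
  obtain ⟨K, k, hk, hK⟩ := deflationsWithKernel_iff.1 hp
  exact (h.ext1Vanishes hC hK).hasLiftingProperty hd hk

/-- An inflation has cokernel in `𝒳` if it lifts against all deflations with kernel in `𝒴`. -/
lemma left_of_llp {X B C : A} {i : X ⟶ B} {d : B ⟶ C} (hi : E.IsConflation i d)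
    (hl : (E.deflationsWithKernel 𝒴).llp i) : 𝒳 C :=
  (h.1 C).2 fun Y hY => ext1Vanishes_of_section fun M j p hp => by
    have := hl p (deflationsWithKernel_iff.2 ⟨_, _, hp, hY⟩)
    have sq : CommSq (0 : X ⟶ M) i p d := ⟨by simp [hi.w]⟩
    obtain ⟨s, hs⟩ := hi.exists_desc sq.lift sq.fac_left
    have := hi.epi
    exact ⟨s, by rw [← cancel_epi d, reassoc_of% hs, sq.fac_right, Category.comp_id]⟩

/-- Left lifting properties compose, and `left_of_llp` turns this back into a statement about the
cokernel, so no extension of cokernels has to be examined. -/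
lemma inflationsWithCokernel_comp {X Y Z : A} {i : X ⟶ Y} {j : Y ⟶ Z}
    (hi : E.inflationsWithCokernel 𝒳 i) (hj : E.inflationsWithCokernel 𝒳 j) :
    E.inflationsWithCokernel 𝒳 (i ≫ j) := by
  obtain ⟨C, d, hd, hC⟩ := inflationsWithCokernel_iff.1 hi
  obtain ⟨C', d', hd', hC'⟩ := inflationsWithCokernel_iff.1 hj
  obtain ⟨V, e, he⟩ := hd.exists_comp hd'
  refine inflationsWithCokernel_iff.2 ⟨V, e, he, h.left_of_llp he fun Z W p hp => ?_⟩
  have := h.hasLiftingProperty hi hp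
  have := h.hasLiftingProperty hj hp
  infer_instance

lemma left_of_extension {X₁ X₂ X₃ : A} {i : X₁ ⟶ X₂} {d : X₂ ⟶ X₃} (hc : E.IsConflation i d)
    (h₁ : 𝒳 X₁) (h₃ : 𝒳 X₃) : 𝒳 X₂ := by
  refine h.left_of_llp (E.isConflation_zero_id X₂) fun Z W p hp => ?_
  have := h.hasLiftingProperty
    (inflationsWithCokernel_iff.2 ⟨_, _, E.isConflation_zero_id X₁, h₁⟩) hp
  have := h.hasLiftingProperty (inflationsWithCokernel_iff.2 ⟨_, _, hc, h₃⟩) hp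
  have e : (0 : 0 ⟶ X₂) = (0 : 0 ⟶ X₁) ≫ i := by simp
  rw [e]
  infer_instance

end IsCotorsionPair

/-- For a complete cotorsion pair, every morphism is an inflation with cokernel in `𝒳` followed by
a deflation with kernel in `𝒴`. -/
lemma IsCompletePair.exists_factorization {𝒳 𝒴 : ObjectProperty A} (hc : E.IsCompletePair 𝒳 𝒴)
    (h : E.IsCotorsionPair 𝒳 𝒴) {X B : A} (f : X ⟶ B) : ∃ (Z : A) (i : X ⟶ Z) (p : Z ⟶ B),
      E.inflationsWithCokernel 𝒳 i ∧ E.deflationsWithKernel 𝒴 p ∧ i ≫ p = f := by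
  obtain ⟨⟨Y, P, j, d, w, hY, hP, hd⟩, -⟩ := hc B
  -- Adding the 𝒳-cover `P` of `B` to the source makes `f` a deflation; a pushout then replaces its
  -- kernel by an object of 𝒴. The two inflations so introduced have cokernels `P` and `X'`.
  obtain ⟨K, k, hk⟩ := exists_isConflation_of_isDeflationOf
    (isDeflationOf_desc f (IsConflation.isDeflationOf (i := j) ⟨w, hd⟩))
  obtain ⟨-, Y', X', a, b, w', hY', hX', hab⟩ := hc K
  obtain ⟨Z, a', k', p, sq, hp, hkp⟩ := hk.exists_pushout a
  obtain ⟨b', -, hb'⟩ := IsConflation.of_isPushout (i := a) (d := b) ⟨w', hab⟩ sq.flip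
  refine ⟨Z, biprod.inr ≫ a', p, h.inflationsWithCokernel_comp
    (inflationsWithCokernel_iff.2 ⟨_, _, E.isConflation_biprod' P X, hP⟩)
    (inflationsWithCokernel_iff.2 ⟨_, _, hb', hX'⟩),
    deflationsWithKernel_iff.2 ⟨_, _, hkp, hY'⟩, by simp [hp]⟩

end ExactStructure

end ExactCat

/-! ### Morphisms modulo the core and the dual `ω`-model structure -/

namespace ExactCat

/-- `f` factors through an object of `ω`. -/
def FactorsThroughClass {A : Type u} [Category.{v} A] (ω : ObjectProperty A) {X Y : A}
    (f : X ⟶ Y) : Prop :=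
  ∃ (W : A) (a : X ⟶ W) (b : W ⟶ Y), ω W ∧ a ≫ b = f

namespace FactorsThroughClass

section

variable {A : Type u} [Category.{v} A] {ω : ObjectProperty A}

lemma comp_left {X Y Z : A} (f : X ⟶ Y) {g : Y ⟶ Z} (hg : FactorsThroughClass ω g) :
    FactorsThroughClass ω (f ≫ g) := by
  obtain ⟨W, a, b, hW, rfl⟩ := hg
  exact ⟨W, f ≫ a, b, hW, by simp⟩

lemma comp_right {X Y Z : A} {f : X ⟶ Y} (hf : FactorsThroughClass ω f) (g : Y ⟶ Z) :
    FactorsThroughClass ω (f ≫ g) := by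
  obtain ⟨W, a, b, hW, rfl⟩ := hf
  exact ⟨W, a, b ≫ g, hW, by simp⟩

end

variable {A : Type u} [Category.{v} A] [Preadditive A] {ω : ObjectProperty A}

lemma neg {X Y : A} {f : X ⟶ Y} (hf : FactorsThroughClass ω f) : FactorsThroughClass ω (-f) := by
  obtain ⟨W, a, b, hW, rfl⟩ := hf
  exact ⟨W, a, -b, hW, by simp⟩

variable [HasBinaryBiproducts A]

lemma add (hω : ∀ X Y, ω X → ω Y → ω (X ⊞ Y)) {X Y : A} {f g : X ⟶ Y}
    (hf : FactorsThroughClass ω f) (hg : FactorsThroughClass ω g) :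
    FactorsThroughClass ω (f + g) := by
  obtain ⟨W, a, b, hW, rfl⟩ := hf
  obtain ⟨W', a', b', hW', rfl⟩ := hg
  exact ⟨W ⊞ W', biprod.lift a a', biprod.desc b b', hω _ _ hW hW', by simp⟩

lemma sub (hω : ∀ X Y, ω X → ω Y → ω (X ⊞ Y)) {X Y : A} {f g : X ⟶ Y}
    (hf : FactorsThroughClass ω f) (hg : FactorsThroughClass ω g) :
    FactorsThroughClass ω (f - g) :=
  sub_eq_add_neg f g ▸ hf.add hω hg.neg

end FactorsThroughClass

section StableEquivalences

variable {A : Type u} [Category.{v} A] [Preadditive A]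

/-- The morphisms inducing bijections `Hom(-, Y)/ω` for all `Y` in `𝒴`. -/
def stableEquivalences (ω 𝒴 : ObjectProperty A) : MorphismProperty A := fun B C f =>
  ∀ Y, 𝒴 Y → (∀ g : B ⟶ Y, ∃ h : C ⟶ Y, FactorsThroughClass ω (g - f ≫ h)) ∧
    ∀ h : C ⟶ Y, FactorsThroughClass ω (f ≫ h) → FactorsThroughClass ω h

variable {ω 𝒴 : ObjectProperty A}

instance : (stableEquivalences ω 𝒴).IsStableUnderRetracts where
  of_retract {X Y Z W f g} r hg T hT := by
    have hl (a : X ⟶ T) : r.i.left ≫ r.r.left ≫ a = a :=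
      (Category.assoc _ _ _).symm.trans ((r.retract_left =≫ a).trans (Category.id_comp a))
    have hr (a : Y ⟶ T) : r.i.right ≫ r.r.right ≫ a = a :=
      (Category.assoc _ _ _).symm.trans ((r.retract_right =≫ a).trans (Category.id_comp a))
    refine ⟨fun a => ?_, fun b hb => ?_⟩
    · obtain ⟨b, hb⟩ := (hg T hT).1 (r.r.left ≫ a)
      refine ⟨r.i.right ≫ b, ?_⟩
      have := hb.comp_left r.i.left
      rwa [Preadditive.comp_sub, hl, reassoc_of% r.i_w] at this
    · have := ((hg T hT).2 (r.r.right ≫ b) (by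
        rw [← reassoc_of% r.r_w]
        exact hb.comp_left _)).comp_left r.i.right
      rwa [hr] at this

/-- Bijections satisfy two-out-of-three; closure of `ω` under biproducts makes factoring through `ω`
an additive ideal, so that the quotients make sense. -/
lemma stableEquivalences_hasTwoOutOfThreeProperty [HasBinaryBiproducts A]
    (hω : ∀ X Y, ω X → ω Y → ω (X ⊞ Y)) :
    (stableEquivalences ω 𝒴).HasTwoOutOfThreeProperty where
  comp_mem f g hf hg Y hY := by
    refine ⟨fun a => ?_, fun c hc => (hg Y hY).2 c ((hf Y hY).2 _ (by simpa using hc))⟩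
    obtain ⟨b, hb⟩ := (hf Y hY).1 a
    obtain ⟨c, hc⟩ := (hg Y hY).1 b
    exact ⟨c, by simpa using hb.add hω (hc.comp_left f)⟩
  of_postcomp f g hg hfg Y hY := by
    refine ⟨fun a => ?_, fun b hb => ?_⟩
    · obtain ⟨c, hc⟩ := (hfg Y hY).1 a
      exact ⟨g ≫ c, by simpa using hc⟩
    · obtain ⟨c, hc⟩ := (hg Y hY).1 b
      have h := (hfg Y hY).2 c (by simpa using hb.sub hω (hc.comp_left f))
      simpa using hc.add hω (h.comp_left g)
  of_precomp f g hf hfg Y hY := by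
    refine ⟨fun b => ?_, fun c hc => (hfg Y hY).2 c (by simpa using hc.comp_left f)⟩
    obtain ⟨c, hc⟩ := (hfg Y hY).1 (f ≫ b)
    exact ⟨c, (hf Y hY).2 _ (by simpa using hc)⟩

end StableEquivalences

namespace ExactStructure

open scoped ZeroObject

variable {A : Type u} [Category.{v} A] [Preadditive A] [HasZeroObject A] [HasBinaryBiproducts A]
  {E : ExactStructure A}

section

variable {𝒳 𝒴 : ObjectProperty A} (h : E.IsCotorsionPair 𝒳 𝒴)

include h

namespace IsCotorsionPair

lemma core_biprod (X Y : A) (hX : (𝒳 ⊓ 𝒴) X) (hY : (𝒳 ⊓ 𝒴) Y) : (𝒳 ⊓ 𝒴) (X ⊞ Y) := by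
  refine ⟨h.left_of_extension (E.isConflation_biprod X Y) hX.1 hY.1, (h.2 _).2 fun T hT => ?_⟩
  refine ext1Vanishes_of_section fun M i d hc => ?_
  obtain ⟨a, ha⟩ := (h.ext1Vanishes hT hX.2).exists_extension hc biprod.fst
  obtain ⟨b, hb⟩ := (h.ext1Vanishes hT hY.2).exists_extension hc biprod.snd
  obtain ⟨s, hs, -⟩ := hc.exists_section_of_retraction (r := biprod.lift a b)
    (by ext <;> simp [ha, hb])
  exact ⟨s, hs⟩

lemma core_of_retract {X Y : A} (hY : (𝒳 ⊓ 𝒴) Y) (r : Retract X Y) : (𝒳 ⊓ 𝒴) X :=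
  ⟨h.left_of_retract hY.1 r, h.right_of_retract hY.2 r⟩

lemma hasTwoOutOfThreeProperty :
    (stableEquivalences (𝒳 ⊓ 𝒴) 𝒴).HasTwoOutOfThreeProperty :=
  stableEquivalences_hasTwoOutOfThreeProperty h.core_biprod

/-- Morphisms from `𝒳` to `𝒴` factor through the core. -/
lemma factorsThroughClass (hc : E.IsCompletePair 𝒳 𝒴) {X Y : A} (hX : 𝒳 X) (hY : 𝒴 Y)
    (f : X ⟶ Y) : FactorsThroughClass (𝒳 ⊓ 𝒴) f := by
  obtain ⟨-, Y', X', i, d, w, hY', hX', hd⟩ := hc X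
  have hd : E.IsConflation i d := ⟨w, hd⟩
  obtain ⟨g, hg⟩ := (h.ext1Vanishes hX' hY).exists_extension hd f
  exact ⟨Y', i, g, ⟨h.left_of_extension hd hX hX', hY'⟩, hg⟩

/-- Surjectivity: a morphism extended along `(f, t)` differs from one factoring through `f` by one
factoring through `t`. Injectivity: extend the first factor of `f ≫ g`; the remaining error descends
to a morphism from 𝒳 to 𝒴, which factors through the core. -/
lemma stableEquivalences_of_weq (hc : E.IsCompletePair 𝒳 𝒴) {B C : A} {f : B ⟶ C}
    (hf : (E.dualOmega (𝒳, 𝒴)).weq f) : stableEquivalences (𝒳 ⊓ 𝒴) 𝒴 f := by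
  obtain ⟨W, t, hW, hi⟩ := hf
  obtain ⟨X, d, hd, hX⟩ := inflationsWithCokernel_iff.1 hi
  refine fun Y hY => ⟨fun g => ?_, fun g hg => ?_⟩
  · obtain ⟨l, hl⟩ := (h.ext1Vanishes hX hY).exists_extension hd g
    refine ⟨biprod.inl ≫ l, W, t, biprod.inr ≫ l, hW, ?_⟩
    simp [← hl, biprod.lift_eq]
  · obtain ⟨W', a, b, hW', hab⟩ := hg
    obtain ⟨l, hl⟩ := (h.ext1Vanishes hX hW'.2).exists_extension hd a
    obtain ⟨c, hc'⟩ := hd.exists_desc (biprod.fst ≫ g - l ≫ b)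
      (by simp [← hab, reassoc_of% hl])
    have e : g = biprod.inl ≫ d ≫ c + (biprod.inl ≫ l) ≫ b := by simp [hc']
    rw [e]
    exact (((h.factorsThroughClass hc hX hY c).comp_left d).comp_left _).add h.core_biprod
      ⟨W', _, _, hW', rfl⟩

lemma dualOmega_weq_of_inflationsWithCokernel {B C : A} {f : B ⟶ C}
    (hf : E.inflationsWithCokernel 𝒳 f) : (E.dualOmega (𝒳, 𝒴)).weq f := by
  obtain ⟨X, d, hd, hX⟩ := inflationsWithCokernel_iff.1 hf
  refine ⟨0, 0, ⟨h.left_zero, h.right_zero⟩,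
    inflationsWithCokernel_iff.2 ⟨X, biprod.fst ≫ d, ?_, hX⟩⟩
  let e : C ≅ C ⊞ (0 : A) :=
    { hom := biprod.inl
      inv := biprod.fst
      hom_inv_id := by simp
      inv_hom_id := by ext; simp }
  exact hd.of_iso (Iso.refl _) e (Iso.refl _) (by ext; simp [e]) (by simp [e])

/-- A deflation with kernel in `𝒴` that is a stable equivalence is a split epimorphism with kernel
in the core. -/
lemma exists_retraction_of_stableEquivalences (hc : E.IsCompletePair 𝒳 𝒴)
    (hh : E.IsHereditaryPair 𝒳 𝒴) {K Z B : A} {k : K ⟶ Z} {p : Z ⟶ B} (hp : E.IsConflation k p)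
    (hK : 𝒴 K) (hs : stableEquivalences (𝒳 ⊓ 𝒴) 𝒴 p) :
    (𝒳 ⊓ 𝒴) K ∧ ∃ r : Z ⟶ K, k ≫ r = 𝟙 K := by
  have := h.hasTwoOutOfThreeProperty
  -- Replace `p` by its pushout `q : Y ⟶ V`, which has the same kernel. By heredity both ends lie in
  -- 𝒴, so the stable equivalence `q` is invertible modulo the core.
  obtain ⟨-, Y, X, j, e, w, hY, hX, he⟩ := hc Z
  have he : E.IsConflation j e := ⟨w, he⟩
  obtain ⟨V, q, b, e', sq, -, hb⟩ := he.exists_pushout p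
  have hq := hp.comp he sq
  have hV : 𝒴 V := hh.2 _ hq.2 hK hY
  have hqs : stableEquivalences (𝒳 ⊓ 𝒴) 𝒴 q := by
    have hsj := h.stableEquivalences_of_weq hc (h.dualOmega_weq_of_inflationsWithCokernel
      (inflationsWithCokernel_iff.2 ⟨_, _, he, hX⟩))
    have hsb := h.stableEquivalences_of_weq hc (h.dualOmega_weq_of_inflationsWithCokernel
      (inflationsWithCokernel_iff.2 ⟨_, _, hb, hX⟩))
    refine MorphismProperty.of_precomp _ j q hsj ?_
    rw [sq.w]
    exact MorphismProperty.comp_mem _ _ _ hs hsb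
  obtain ⟨s, hqs₁⟩ := (hqs Y hY).1 (𝟙 Y)
  obtain ⟨W, c, d, hW, hcd⟩ := (hqs V hV).2 (𝟙 V - s ≫ q) (by
    simpa using hqs₁.comp_right q)
  -- The error `𝟙 V - s ≫ q` factors through the core, hence lifts along `q`; adding the lift to `s`
  -- gives a genuine section.
  obtain ⟨d', hd'⟩ := (h.ext1Vanishes hW.1 hK).exists_lift hq d
  obtain ⟨r, hr, -⟩ := hq.exists_retraction_of_section (s := s + c ≫ d') (by
    simp [hd', hcd])
  refine ⟨?_, j ≫ r, by simpa using hr⟩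
  -- Since `k ≫ j ≫ q = 0`, the morphism `k ≫ j` itself factors through the core, so `K` is a
  -- retract of a core object.
  obtain ⟨W', a, b, hW', hab⟩ := hqs₁.comp_left (k ≫ j)
  refine h.core_of_retract hW' ⟨a, b ≫ r, ?_⟩
  rw [reassoc_of% hab]
  simpa [reassoc_of% hq.w] using hr

lemma dualOmega_weq_iff (hc : E.IsCompletePair 𝒳 𝒴) (hh : E.IsHereditaryPair 𝒳 𝒴) {B C : A}
    {f : B ⟶ C} : (E.dualOmega (𝒳, 𝒴)).weq f ↔ stableEquivalences (𝒳 ⊓ 𝒴) 𝒴 f := by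
  refine ⟨h.stableEquivalences_of_weq hc, fun hf => ?_⟩
  have := h.hasTwoOutOfThreeProperty
  obtain ⟨Z, i, p, hi, hp, rfl⟩ := hc.exists_factorization h f
  obtain ⟨K, k, hk, hK⟩ := deflationsWithKernel_iff.1 hp
  obtain ⟨hW, r, hr⟩ := h.exists_retraction_of_stableEquivalences hc hh hk hK
    (MorphismProperty.of_precomp _ i p (h.stableEquivalences_of_weq hc
      (h.dualOmega_weq_of_inflationsWithCokernel hi)) hf)
  obtain ⟨s, hs, hrs⟩ := hk.exists_section_of_retraction hr
  obtain ⟨X, d, hd, hX⟩ := inflationsWithCokernel_iff.1 hi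
  have := hk.mono
  have hsr : s ≫ r = 0 := by
    rw [← cancel_mono k, Category.assoc, eq_sub_of_add_eq hrs]
    simp [reassoc_of% hs]
  let e : Z ≅ C ⊞ K :=
    { hom := biprod.lift p r
      inv := biprod.desc s k
      hom_inv_id := by simpa [add_comm] using hrs
      inv_hom_id := by ext <;> simp [hs, hsr, hr, hk.w] }
  exact ⟨K, i ≫ r, hW, inflationsWithCokernel_iff.2 ⟨X, e.inv ≫ d,
    hd.of_iso (Iso.refl _) e (Iso.refl _) (by ext <;> simp [e]) (by simp), hX⟩⟩

end IsCotorsionPair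

/-- The trivial cofibrations of the dual `ω`-model structure. -/
lemma IsCotorsionPair.dualOmega_trivial_cofib_iff (hA : WeaklyIdempotentComplete A)
    {B C : A} {f : B ⟶ C} : (E.dualOmega (𝒳, 𝒴)).cofib f ∧ (E.dualOmega (𝒳, 𝒴)).weq f ↔
      E.inflationsWithCokernel 𝒳 f := by
  refine ⟨?_, fun hf => ⟨fun W _ hW g => ?_, h.dualOmega_weq_of_inflationsWithCokernel hf⟩⟩
  · rintro ⟨hf, W, t, hW, hi⟩
    obtain ⟨X, d, hd, hX⟩ := inflationsWithCokernel_iff.1 hi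
    obtain ⟨s, hs⟩ := hf W hW.1 hW.2 t
    dsimp at hs
    -- As `t` extends along `f` to `s`, this shear carries `(f, t)` to `(f, 0)`.
    let e : C ⊞ W ≅ C ⊞ W :=
      { hom := biprod.lift biprod.fst (biprod.desc (-s) (𝟙 W))
        inv := biprod.lift biprod.fst (biprod.desc s (𝟙 W))
        hom_inv_id := by ext <;> simp
        inv_hom_id := by ext <;> simp }
    have hd' : E.IsConflation (biprod.lift f 0) (e.inv ≫ d) :=
      hd.of_iso (Iso.refl _) e (Iso.refl _) (by ext <;> simp [e, biprod.lift_desc, hs]) (by simp)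
    obtain ⟨K, q, hq, ⟨r⟩⟩ := exists_isConflation_of_lift_zero hA hd'
    exact inflationsWithCokernel_iff.2 ⟨K, q, hq, h.left_of_retract hX r⟩
  · obtain ⟨X, d, hd, hX⟩ := inflationsWithCokernel_iff.1 hf
    exact (h.ext1Vanishes hX hW).exists_extension hd g

/-- The trivial fibrations of the dual `ω`-model structure split. -/
lemma IsCotorsionPair.dualOmega_trivial_fib (hc : E.IsCompletePair 𝒳 𝒴)
    (hh : E.IsHereditaryPair 𝒳 𝒴) {Z B : A} {p : Z ⟶ B} (hp : (E.dualOmega (𝒳, 𝒴)).fib p)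
    (hw : (E.dualOmega (𝒳, 𝒴)).weq p) : ∃ (K : A) (k : K ⟶ Z) (r : Z ⟶ K),
      (𝒳 ⊓ 𝒴) K ∧ E.IsConflation k p ∧ k ≫ r = 𝟙 K := by
  obtain ⟨K, k, hk, hK⟩ := deflationsWithKernel_iff.1 hp
  obtain ⟨hW, r, hr⟩ := h.exists_retraction_of_stableEquivalences hc hh hk hK
    (h.stableEquivalences_of_weq hc hw)
  exact ⟨K, k, r, hW, hk, hr⟩

end

lemma dualOmega_trivial_fib_of_retraction {𝒳 𝒴 : ObjectProperty A} {K Z B : A} {k : K ⟶ Z}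
    {p : Z ⟶ B} {r : Z ⟶ K} (hx : 𝒳 0) (hK : (𝒳 ⊓ 𝒴) K) (hp : E.IsConflation k p)
    (hr : k ≫ r = 𝟙 K) : (E.dualOmega (𝒳, 𝒴)).fib p ∧ (E.dualOmega (𝒳, 𝒴)).weq p := by
  refine ⟨deflationsWithKernel_iff.2 ⟨K, k, hp, hK.2⟩, K, r, hK,
    inflationsWithCokernel_iff.2 ⟨0, 0, ?_, hx⟩⟩
  obtain ⟨s, hs, hrs⟩ := hp.exists_section_of_retraction hr
  have := hp.mono
  have hsr : s ≫ r = 0 := by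
    rw [← cancel_mono k, Category.assoc, eq_sub_of_add_eq hrs]
    simp [reassoc_of% hs]
  let e : Z ≅ B ⊞ K :=
    { hom := biprod.lift p r
      inv := biprod.desc s k
      hom_inv_id := by simpa [add_comm] using hrs
      inv_hom_id := by ext <;> simp [hs, hsr, hr, hp.w] }
  exact (E.isConflation_id_zero Z).of_iso (Iso.refl _) e (Iso.refl _) (by simp [e]) (by simp)

/-- `ω`-monic morphisms lift against split epimorphisms with kernel in `ω`. -/
lemma hasLiftingProperty_of_retraction {𝒳 𝒴 : ObjectProperty A} {X Y K Z B : A} {i : X ⟶ Y}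
    {k : K ⟶ Z} {p : Z ⟶ B} {r : Z ⟶ K} (hi : (E.dualOmega (𝒳, 𝒴)).cofib i) (hK : (𝒳 ⊓ 𝒴) K)
    (hp : E.IsConflation k p) (hr : k ≫ r = 𝟙 K) : HasLiftingProperty i p := by
  refine ⟨fun {u v} sq => ?_⟩
  obtain ⟨s, hs, hrs⟩ := hp.exists_section_of_retraction hr
  obtain ⟨m, hm⟩ := hi K hK.1 hK.2 (u ≫ r)
  dsimp at hm
  refine ⟨⟨⟨m ≫ k + v ≫ s, ?_, by simp [hp.w, hs]⟩⟩⟩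
  rw [Preadditive.comp_add, reassoc_of% hm, ← sq.w_assoc, ← Preadditive.comp_add, hrs,
    Category.comp_id]

/-- Followed by a split epimorphism, the deflation `g` factors through `f`, so `f` is a deflation by
weak idempotent completeness; its kernel is a retract of that of `g`. -/
lemma deflationsWithKernel_isStableUnderRetracts (hA : WeaklyIdempotentComplete A)
    {𝒴 : ObjectProperty A} (hY : ∀ ⦃X Y : A⦄, 𝒴 Y → Retract X Y → 𝒴 X) :
    (E.deflationsWithKernel 𝒴).IsStableUnderRetracts where
  of_retract {X Y Z W f g} r hg := by
    obtain ⟨K, k, hk, hK⟩ := deflationsWithKernel_iff.1 hg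
    obtain ⟨N, n, t, hn, -, -⟩ := exists_isConflation_of_splitEpi (E := E) hA _ _ r.retract_right
    have := E.comp_deflation _ _ hk.isDeflationOf hn.isDeflationOf
    rw [← r.r_w] at this
    obtain ⟨L, l, hl⟩ := exists_isConflation_of_isDeflationOf (isDeflationOf_of_comp hA _ _ this)
    obtain ⟨a, ha⟩ := hk.exists_lift (l ≫ r.i.left) (by simp [r.i_w, reassoc_of% hl.w])
    obtain ⟨b, hb⟩ := hl.exists_lift (k ≫ r.r.left) (by simp [r.r_w, reassoc_of% hk.w])
    have := hl.mono
    refine deflationsWithKernel_iff.2 ⟨L, l, hl, hY hK ⟨a, b, ?_⟩⟩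
    rw [← cancel_mono l, Category.assoc, hb, reassoc_of% ha, r.retract_left]
    simp

lemma dualOmega_cofib_isStableUnderRetracts (P : ObjectProperty A × ObjectProperty A) :
    (E.dualOmega P).cofib.IsStableUnderRetracts where
  of_retract {X Y Z W f g} r hg T h₁ h₂ a := by
    obtain ⟨b, hb⟩ := hg T h₁ h₂ (r.r.left ≫ a)
    dsimp at hb
    exact ⟨r.i.right ≫ b, by simp [← reassoc_of% r.i_w, hb, reassoc_of% r.retract_left]⟩

lemma isModelStructure_dualOmega (hA : WeaklyIdempotentComplete A)
    {P : ObjectProperty A × ObjectProperty A} (hP : P ∈ E.cotorsionPairs) :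
    (E.dualOmega P).IsModelStructure := by
  obtain ⟨𝒳, 𝒴⟩ := P
  obtain ⟨h, hc, hh, hf⟩ := hP
  dsimp at h hc hh hf
  have hw : (E.dualOmega (𝒳, 𝒴)).weq = stableEquivalences (𝒳 ⊓ 𝒴) 𝒴 := by
    ext X Y f
    exact h.dualOmega_weq_iff hc hh
  refine ⟨?_, dualOmega_cofib_isStableUnderRetracts _,
    deflationsWithKernel_isStableUnderRetracts hA fun X Y hY r => h.right_of_retract hY r, ?_,
    ?_, fun X Y f => ?_, fun X Y f => ?_⟩
  · rw [hw]
    exact h.hasTwoOutOfThreeProperty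
  · rw [hw]
    infer_instance
  · rintro X Y Z W i p hi hp (hw | hw)
    · exact h.hasLiftingProperty ((h.dualOmega_trivial_cofib_iff hA).1 ⟨hi, hw⟩) hp
    · obtain ⟨K, k, r, hK, hk, hr⟩ := h.dualOmega_trivial_fib hc hh hp hw
      exact hasLiftingProperty_of_retraction hi hK hk hr
  · obtain ⟨Z, i, p, hi, hp, hip⟩ := hc.exists_factorization h f
    have := (h.dualOmega_trivial_cofib_iff hA).2 hi
    exact ⟨Z, i, p, this.1, this.2, hp, hip⟩
  -- With `w` a left `ω`-approximation of `X`, the morphism `(f, w)` is `ω`-monic because `w` is.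
  · obtain ⟨W, w, hW, hw⟩ := hf X
    obtain ⟨h₁, h₂⟩ := dualOmega_trivial_fib_of_retraction h.left_zero hW
      (E.isConflation_biprod' Y W) (biprod.inr_snd)
    refine ⟨Y ⊞ W, biprod.lift f w, biprod.fst, fun T hT₁ hT₂ g => ?_, h₁, h₂, by simp⟩
    obtain ⟨m, hm⟩ := hw g ⟨hT₁, hT₂⟩
    exact ⟨biprod.snd ≫ m, by simp [hm]⟩

end ExactStructure

end ExactCat

/-! ### Weak factorization systems of a model structure -/

namespace ExactCat

open scoped ZeroObject

namespace MorphismTriple.IsModelStructure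

variable {A : Type u} [Category.{v} A] {M : MorphismTriple A} (hM : M.IsModelStructure)

include hM

lemma isWeakFactorizationSystem_trivial_cofib_fib :
    (M.cofib ⊓ M.weq).IsWeakFactorizationSystem M.fib := by
  have := hM.retract_cofib
  have := hM.retract_weq
  have := hM.retract_fib
  have : (M.cofib ⊓ M.weq).HasFactorization M.fib := ⟨fun f => by
    obtain ⟨Z, i, p, hi, hi', hp, hf⟩ := hM.factor_trivial_cofib f
    exact ⟨⟨Z, i, p, hf, ⟨hi, hi'⟩, hp⟩⟩⟩
  exact .mk' _ _ fun i p hi hp => hM.lifting i p hi.1 hp (Or.inl hi.2)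

lemma isWeakFactorizationSystem_cofib_trivial_fib :
    M.cofib.IsWeakFactorizationSystem (M.fib ⊓ M.weq) := by
  have := hM.retract_cofib
  have := hM.retract_weq
  have := hM.retract_fib
  have : M.cofib.HasFactorization (M.fib ⊓ M.weq) := ⟨fun f => by
    obtain ⟨Z, i, p, hi, hp, hp', hf⟩ := hM.factor_trivial_fib f
    exact ⟨⟨Z, i, p, hf, hi, ⟨hp, hp'⟩⟩⟩⟩
  exact .mk' _ _ fun i p hi hp => hM.lifting i p hi hp.1 (Or.inr hp.2)

lemma llp_fib : M.fib.llp = M.cofib ⊓ M.weq :=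
  hM.isWeakFactorizationSystem_trivial_cofib_fib.llp

lemma rlp_trivial_cofib : (M.cofib ⊓ M.weq).rlp = M.fib :=
  hM.isWeakFactorizationSystem_trivial_cofib_fib.rlp

lemma llp_trivial_fib : (M.fib ⊓ M.weq).llp = M.cofib :=
  hM.isWeakFactorizationSystem_cofib_trivial_fib.llp

lemma rlp_cofib : M.cofib.rlp = M.fib ⊓ M.weq :=
  hM.isWeakFactorizationSystem_cofib_trivial_fib.rlp

lemma weq_id (X : A) : M.weq (𝟙 X) := by
  have : M.fib.llp (𝟙 X) := MorphismProperty.llp_of_isIso _ _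
  rw [hM.llp_fib] at this
  exact this.2

/-- Weak equivalences are determined by cofibrations and fibrations. -/
lemma weq_le {M' : MorphismTriple A} (hM' : M'.IsModelStructure) (hc : M.cofib = M'.cofib)
    (hf : M.fib = M'.fib) : M.weq ≤ M'.weq := fun X Y f hw => by
  have := hM.two_out_of_three
  have := hM'.two_out_of_three
  obtain ⟨Z, i, p, hi, hi', hp, rfl⟩ := hM.factor_trivial_cofib f
  have hp' : M.weq p := M.weq.of_precomp i p hi' hw
  have hi₁ : (M.cofib ⊓ M.weq) i := ⟨hi, hi'⟩
  have hp₁ : (M.fib ⊓ M.weq) p := ⟨hp, hp'⟩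
  rw [← hM.llp_fib, hf, hM'.llp_fib] at hi₁
  rw [← hM.rlp_cofib, hc, hM'.rlp_cofib] at hp₁
  exact M'.weq.comp_mem _ _ hi₁.2 hp₁.2

lemma weq_zero_iff [HasZeroMorphisms A] [HasZeroObject A] (X : A) :
    M.weq (0 : X ⟶ 0) ↔ M.trivialObj X := by
  have := hM.two_out_of_three
  have h : M.weq ((0 : 0 ⟶ X) ≫ (0 : X ⟶ 0)) := by
    rw [(isZero_zero A).eq_of_src ((0 : 0 ⟶ X) ≫ (0 : X ⟶ 0)) (𝟙 0)]
    exact hM.weq_id _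
  exact ⟨fun hX => M.weq.of_postcomp _ _ hX h, fun hX => M.weq.of_precomp _ _ hX h⟩

end MorphismTriple.IsModelStructure

/-! ### From weakly injective model structures to cotorsion pairs, and the inverse bijections -/

namespace ExactStructure

variable {A : Type u} [Category.{v} A] [Preadditive A] [HasZeroObject A] [HasBinaryBiproducts A]
  {E : ExactStructure A}

/-- `0 ⟶ C` is the cobase change of `i` along `X ⟶ 0`. -/
lemma IsConflation.hasLiftingProperty_zero {X Y C Z W : A} {i : X ⟶ Y} {d : Y ⟶ C}
    (hi : E.IsConflation i d) (p : Z ⟶ W) [HasLiftingProperty i p] :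
    HasLiftingProperty (0 : 0 ⟶ C) p := by
  refine ⟨fun {u v} sq => ?_⟩
  have sq' : CommSq (0 : X ⟶ Z) i p (d ≫ v) := ⟨by simp [reassoc_of% hi.w]⟩
  obtain ⟨s, hs⟩ := hi.exists_desc sq'.lift sq'.fac_left
  have := hi.epi
  exact ⟨⟨⟨s, (isZero_zero A).eq_of_src _ _, by
    rw [← cancel_epi d, reassoc_of% hs, sq'.fac_right]⟩⟩⟩

/-- For complete cotorsion pairs, closure of the left class under kernels of deflations implies
closure of the right class under cokernels of inflations. -/
lemma IsCotorsionPair.right_of_left_hereditary {𝒳 𝒴 : ObjectProperty A}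
    (h : E.IsCotorsionPair 𝒳 𝒴) (hc : E.IsCompletePair 𝒳 𝒴)
    (hX : ∀ S, E.conflation S → 𝒳 S.X₂ → 𝒳 S.X₃ → 𝒳 S.X₁) {Y₁ Y₂ Y₃ : A} {i : Y₁ ⟶ Y₂}
    {d : Y₂ ⟶ Y₃} (hi : E.IsConflation i d) (h₁ : 𝒴 Y₁) (h₂ : 𝒴 Y₂) : 𝒴 Y₃ := by
  refine (h.2 _).2 fun X hXX => ext1Vanishes_of_section fun M j e he => ?_
  obtain ⟨⟨Y, P, k, p, w, hY, hP, hp⟩, -⟩ := hc M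
  have hp : E.IsConflation k p := ⟨w, hp⟩
  obtain ⟨N, j', p', k', sq, hk', hN⟩ := hp.exists_pullback j
  have := he.mono
  have hj' : E.IsConflation j' (p ≫ e) := by
    obtain ⟨Q, q, hq⟩ := exists_isConflation_of_isDeflationOf
      (E.comp_deflation _ _ hp.isDeflationOf he.isDeflationOf)
    have : Mono j' := ⟨fun a b hab => sq.hom_ext hab (by
      rw [← cancel_mono j, Category.assoc, Category.assoc, ← sq.w, reassoc_of% hab])⟩
    refine hq.of_kernel j' (by rw [reassoc_of% sq.w, he.w, comp_zero]) fun T x hx => ?_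
    obtain ⟨a, ha⟩ := he.exists_lift (x ≫ p) (by simpa using hx)
    obtain ⟨l, hl, -⟩ := sq.exists_lift x a ha.symm
    exact ⟨l, hl⟩
  -- `N` is the kernel of `P ⟶ M ⟶ X`. The morphism `N ⟶ Y₃` lifts to `Y₂` and then extends to `P`;
  -- composed with `d` it descends to a retraction of `j`.
  have hNX : 𝒳 N := hX _ hj'.2 hP hXX
  obtain ⟨a, ha⟩ := (h.ext1Vanishes hNX h₁).exists_lift hi p'
  obtain ⟨b, hb⟩ := (h.ext1Vanishes hXX h₂).exists_extension hj' a
  obtain ⟨r, hr⟩ := hp.exists_desc (b ≫ d) (by rw [← hk', Category.assoc, reassoc_of% hb, ha, hN.w])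
  have := hN.epi
  obtain ⟨s, hs, -⟩ := he.exists_section_of_retraction (r := r) (by
    rw [← cancel_epi p', ← reassoc_of% sq.w, hr, reassoc_of% hb, ha, Category.comp_id])
  exact ⟨s, hs⟩

section WeaklyInjective

variable {M : MorphismTriple A} (hM : M ∈ E.weaklyInjectiveModelStructures)

include hM

lemma fib_iff_of_weaklyInjective {X Y : A} {p : X ⟶ Y} :
    M.fib p ↔ ∃ (K : A) (i : K ⟶ X), E.IsConflation i p ∧ M.fibrant K := by
  rw [hM.2.1, deflationsWithKernel_iff]

lemma ext1Vanishes_of_weaklyInjective {X Y : A} (hX : M.triviallyCofibrant X)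
    (hY : M.fibrant Y) : E.Ext1Vanishes X Y :=
  ext1Vanishes_of_section fun T i d hc => by
    have := hM.1.lifting (0 : 0 ⟶ X) d hX.1 ((fib_iff_of_weaklyInjective hM).2 ⟨_, _, hc, hY⟩)
      (Or.inl hX.2)
    have sq : CommSq (0 : 0 ⟶ T) 0 d (𝟙 X) := ⟨by simp⟩
    exact ⟨sq.lift, sq.fac_right⟩

lemma inflationsWithCokernel_of_weaklyInjective {X Y : A} {f : X ⟶ Y} (hf : M.cofib f)
    (hw : M.weq f) : E.inflationsWithCokernel M.triviallyCofibrant f := by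
  obtain ⟨C, d, hd⟩ := exists_isConflation_of_isInflationOf (hM.2.2.1 f hf hw)
  refine inflationsWithCokernel_iff.2 ⟨C, d, hd, ?_⟩
  have : M.fib.llp (0 : 0 ⟶ C) := fun Z W p hp => by
    have := hM.1.lifting f p hf hp (Or.inl hw)
    exact hd.hasLiftingProperty_zero p
  rwa [hM.1.llp_fib] at this

lemma isCotorsionPair_of_weaklyInjective : E.IsCotorsionPair M.triviallyCofibrant M.fibrant := by
  refine ⟨fun X => ⟨fun hX Y hY => ext1Vanishes_of_weaklyInjective hM hX hY, fun hX => ?_⟩,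
    fun Y => ⟨fun hY X hX => ext1Vanishes_of_weaklyInjective hM hX hY, fun hY => ?_⟩⟩
  · have : M.fib.llp (0 : 0 ⟶ X) := fun Z W p hp => by
      obtain ⟨K, k, hk, hK⟩ := (fib_iff_of_weaklyInjective hM).1 hp
      exact (hX K hK).hasLiftingProperty (E.isConflation_zero_id X) hk
    rwa [hM.1.llp_fib] at this
  · have : (M.cofib ⊓ M.weq).rlp (0 : Y ⟶ 0) := fun Z W i hi => by
      obtain ⟨C, d, hd, hC⟩ := inflationsWithCokernel_iff.1
        (inflationsWithCokernel_of_weaklyInjective hM hi.1 hi.2)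
      exact (hY C hC).hasLiftingProperty hd (E.isConflation_id_zero Y)
    rwa [hM.1.rlp_trivial_cofib] at this

lemma isCompletePair_of_weaklyInjective : E.IsCompletePair M.triviallyCofibrant M.fibrant := by
  refine fun X => ⟨?_, ?_⟩
  · obtain ⟨Z, i, p, hi, hw, hp, -⟩ := hM.1.factor_trivial_cofib (0 : 0 ⟶ X)
    obtain ⟨K, k, hk, hK⟩ := (fib_iff_of_weaklyInjective hM).1 hp
    rw [(isZero_zero A).eq_of_src i 0] at hi hw
    exact ⟨K, Z, k, p, hk.1, hK, ⟨hi, hw⟩, hk.2⟩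
  · obtain ⟨Z, i, p, hi, hw, hp, -⟩ := hM.1.factor_trivial_cofib (0 : X ⟶ 0)
    obtain ⟨C, d, hd, hC⟩ := inflationsWithCokernel_iff.1
      (inflationsWithCokernel_of_weaklyInjective hM hi hw)
    rw [(isZero_zero A).eq_of_tgt p 0] at hp
    exact ⟨Z, C, i, d, hd.1, hp, hC, hd.2⟩

/-- An inflation with trivially cofibrant cokernel is a trivial cofibration, so two-out-of-three
makes the kernel trivial; it is cofibrant for free. The fibrant half follows from this one. -/
lemma isHereditaryPair_of_weaklyInjective :
    E.IsHereditaryPair M.triviallyCofibrant M.fibrant := by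
  have h : ∀ S, E.conflation S → M.triviallyCofibrant S.X₂ → M.triviallyCofibrant S.X₃ →
      M.triviallyCofibrant S.X₁ := fun S hS h₂ h₃ => by
    refine ⟨hM.2.2.2 _, ?_⟩
    have hS' : E.IsConflation S.f S.g := ⟨S.zero, hS⟩
    have hw : M.fib.llp S.f := fun Z W p hp => by
      rw [hM.2.1] at hp
      exact (isCotorsionPair_of_weaklyInjective hM).hasLiftingProperty
        (inflationsWithCokernel_iff.2 ⟨_, _, hS', h₃⟩) hp
    rw [hM.1.llp_fib] at hw
    have := hM.1.two_out_of_three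
    refine M.weq.of_postcomp (0 : 0 ⟶ S.X₁) S.f hw.2 ?_
    rw [zero_comp]
    exact h₂.2
  exact ⟨h, fun S hS h₁ h₂ => (isCotorsionPair_of_weaklyInjective hM).right_of_left_hereditary
    (isCompletePair_of_weaklyInjective hM) h ⟨S.zero, hS⟩ h₁ h₂⟩

lemma dualOmega_cofib_of_weaklyInjective {X Y : A} {f : X ⟶ Y} (hf : M.cofib f) :
    (E.dualOmega M.objectPair).cofib f := fun W hW₁ hW₂ g => by
  have := hM.1.lifting f (0 : W ⟶ 0) hf hW₂ (Or.inr ((hM.1.weq_zero_iff W).2 hW₁.2))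
  have sq : CommSq g f (0 : W ⟶ 0) 0 := ⟨by simp⟩
  exact ⟨sq.lift, sq.fac_left⟩

/-- The approximation is the cofibration in a factorization of `X ⟶ 0`: the middle term lies in the
core, and cofibrations are `ω`-monic. -/
lemma covariantlyFinite_of_weaklyInjective :
    CovariantlyFinite (M.triviallyCofibrant ⊓ M.fibrant) := fun X => by
  obtain ⟨W, j, q, hj, hq, hw, -⟩ := hM.1.factor_trivial_fib (0 : X ⟶ 0)
  rw [(isZero_zero A).eq_of_tgt q 0] at hq hw
  exact ⟨W, j, ⟨⟨hM.2.2.2 W, (hM.1.weq_zero_iff W).1 hw⟩, hq⟩, fun W' g hW' =>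
    dualOmega_cofib_of_weaklyInjective hM hj W' hW'.1 hW'.2 g⟩

lemma objectPair_mem_cotorsionPairs : M.objectPair ∈ E.cotorsionPairs :=
  ⟨isCotorsionPair_of_weaklyInjective hM, isCompletePair_of_weaklyInjective hM,
    isHereditaryPair_of_weaklyInjective hM, covariantlyFinite_of_weaklyInjective hM⟩

/-- Cofibrancy of `B` gives a section of `p`, and `K ⟶ 0` inherits from `p` the right lifting
property against cofibrations. -/
lemma exists_retraction_of_trivial_fib {Z B : A} {p : Z ⟶ B} (hp : M.fib p) (hw : M.weq p) :
    ∃ (K : A) (k : K ⟶ Z) (r : Z ⟶ K), (M.triviallyCofibrant ⊓ M.fibrant) K ∧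
      E.IsConflation k p ∧ k ≫ r = 𝟙 K := by
  obtain ⟨K, k, hk, hK⟩ := (fib_iff_of_weaklyInjective hM).1 hp
  have := hk.mono
  have hKw : M.cofib.rlp (0 : K ⟶ 0) := fun X Y i hi => ⟨fun {u v} sq => by
    have := hM.1.lifting i p hi hp (Or.inr hw)
    have sq' : CommSq (u ≫ k) i p 0 := ⟨by simp [hk.w]⟩
    obtain ⟨l, hl⟩ := hk.exists_lift sq'.lift sq'.fac_right
    exact ⟨⟨⟨l, by rw [← cancel_mono k, Category.assoc, hl, sq'.fac_left],
      (isZero_zero A).eq_of_tgt _ _⟩⟩⟩⟩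
  rw [hM.1.rlp_cofib] at hKw
  have := hM.1.lifting (0 : 0 ⟶ B) p (hM.2.2.2 B) hp (Or.inr hw)
  have sq : CommSq (0 : 0 ⟶ Z) 0 p (𝟙 B) := ⟨by simp⟩
  obtain ⟨r, hr, -⟩ := hk.exists_retraction_of_section sq.fac_right
  exact ⟨K, k, r, ⟨⟨hM.2.2.2 K, (hM.1.weq_zero_iff K).1 hKw.2⟩, hK⟩, hk, hr⟩

/-- An `ω`-monic morphism lifts against all trivial fibrations, since these split with kernel in the
core; hence it is a cofibration. Weak equivalences then agree because the other two classes do. -/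
lemma dualOmega_objectPair (hA : WeaklyIdempotentComplete A) : E.dualOmega M.objectPair = M := by
  have hD := isModelStructure_dualOmega hA (objectPair_mem_cotorsionPairs hM)
  have hfib : (E.dualOmega M.objectPair).fib = M.fib := hM.2.1.symm
  have hcof : (E.dualOmega M.objectPair).cofib = M.cofib := by
    refine le_antisymm (fun X Y f hf => ?_) fun X Y f => dualOmega_cofib_of_weaklyInjective hM
    rw [← hM.1.llp_trivial_fib]
    intro Z W p hp
    obtain ⟨K, k, r, hK, hk, hr⟩ := exists_retraction_of_trivial_fib hM hp.1 hp.2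
    exact hasLiftingProperty_of_retraction hf hK hk hr
  exact MorphismTriple.ext hcof hfib
    (le_antisymm (hD.weq_le hM.1 hcof hfib) (hM.1.weq_le hD hcof.symm hfib.symm))

end WeaklyInjective

lemma objectPair_dualOmega (hA : WeaklyIdempotentComplete A)
    {P : ObjectProperty A × ObjectProperty A} (hP : P ∈ E.cotorsionPairs) :
    (E.dualOmega P).objectPair = P := by
  obtain ⟨𝒳, 𝒴⟩ := P
  have h : E.IsCotorsionPair 𝒳 𝒴 := hP.1
  refine Prod.ext (funext fun X => propext ?_) (funext fun X => propext ?_)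
  · refine (h.dualOmega_trivial_cofib_iff hA).trans
      (inflationsWithCokernel_iff.trans ⟨?_, fun hX => ⟨X, _, E.isConflation_zero_id X, hX⟩⟩)
    rintro ⟨C, d, hd, hC⟩
    obtain ⟨l, hl⟩ := hd.exists_desc (𝟙 X) (by simp)
    exact h.left_of_retract hC ⟨d, l, hl⟩
  · refine deflationsWithKernel_iff.trans
      ⟨?_, fun hX => ⟨X, _, E.isConflation_id_zero X, hX⟩⟩
    rintro ⟨K, k, hk, hK⟩
    obtain ⟨l, hl⟩ := hk.exists_lift (𝟙 X) (by simp)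
    exact h.right_of_retract hK ⟨l, k, hl⟩

lemma dualOmega_mem_weaklyInjectiveModelStructures (hA : WeaklyIdempotentComplete A)
    {P : ObjectProperty A × ObjectProperty A} (hP : P ∈ E.cotorsionPairs) :
    E.dualOmega P ∈ E.weaklyInjectiveModelStructures := by
  have hY : (E.dualOmega P).fibrant = P.2 := congrArg Prod.snd (objectPair_dualOmega hA hP)
  refine ⟨isModelStructure_dualOmega hA hP, by rw [hY]; rfl, fun X Y f hf hw => ?_,
    fun X W _ _ g => ⟨0, (isZero_zero A).eq_of_src _ _⟩⟩
  obtain ⟨C, d, hd, -⟩ := inflationsWithCokernel_iff.1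
    ((hP.1.dualOmega_trivial_cofib_iff hA).1 ⟨hf, hw⟩)
  exact hd.isInflationOf

end ExactStructure

end ExactCat

theorem theorem5p7 {A : Type u} [Category.{v} A] [Preadditive A] [HasZeroObject A]
    [HasBinaryBiproducts A] (E : ExactCat.ExactStructure A)
    (hA : ExactCat.WeaklyIdempotentComplete A) :
    Set.BijOn E.dualOmega E.cotorsionPairs E.weaklyInjectiveModelStructures ∧
    Set.BijOn (fun M => M.objectPair)
      E.weaklyInjectiveModelStructures E.cotorsionPairs ∧
    Set.InvOn (fun M => M.objectPair) (fun P => E.dualOmega P)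
      E.cotorsionPairs E.weaklyInjectiveModelStructures := by
  have hinv : Set.InvOn (fun M => M.objectPair) (fun P => E.dualOmega P)
      E.cotorsionPairs E.weaklyInjectiveModelStructures :=
    ⟨fun _ hP => ExactCat.ExactStructure.objectPair_dualOmega hA hP,
      fun _ hM => ExactCat.ExactStructure.dualOmega_objectPair hM hA⟩
  have h₁ : Set.MapsTo E.dualOmega E.cotorsionPairs E.weaklyInjectiveModelStructures :=
    fun _ hP => ExactCat.ExactStructure.dualOmega_mem_weaklyInjectiveModelStructures hA hP
  have h₂ : Set.MapsTo (fun M : ExactCat.MorphismTriple A => M.objectPair)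
      E.weaklyInjectiveModelStructures E.cotorsionPairs :=
    fun _ hM => ExactCat.ExactStructure.objectPair_mem_cotorsionPairs hM
  exact ⟨hinv.bijOn h₁ h₂, hinv.symm.bijOn h₂ h₁, hinv⟩
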